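/- Let $\mathfrak h=\mathbb C\langle x,y\rangle$ be the vector space spanned by the words in $x,y$, with the shuffle product $\mathbin{\sqcup\!\sqcup}$ (bilinear, $1\mathbin{\sqcup\!\sqcup} w=w\mathbin{\sqcup\!\sqcup} 1=w$, $l_1w_1\mathbin{\sqcup\!\sqcup} l_2w_2=l_1(w_1\mathbin{\sqcup\!\sqcup} l_2w_2)+l_2(l_1w_1\mathbin{\sqcup\!\sqcup} w_2)$ for letters $l_1,l_2$), and put $\mathfrak h^1=\mathbb C1\oplus\mathfrak h y$, $\mathfrak h^0=\mathbb C1\oplus x\mathfrak h y$. Then $\mathfrak h=\bigoplus_{n\ge0}\mathfrak h^1\mathbin{\sqcup\!\sqcup} x^{\mathbin{\sqcup\!\sqcup} n}=\bigoplus_{m,n\ge0}y^{\mathbin{\sqcup\!\sqcup} m}\mathbin{\sqcup\!\sqcup}\mathfrak h^0\mathbin{\sqcup\!\sqcup} x^{\mathbin{\sqcup\!\sqcup} n}$, and the shuffle regularization $\mathrm{reg}:\mathfrak h\to\mathfrak h^0$ takes an element to its $(m,n)=(0,0)$ component in the second decomposition. Let $\widehat\zeta:\mathfrak h^0\to\mathbb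 C$ be the linear map with $\widehat\zeta(1)=1$ and $$\widehat\zeta(x^{k_1-1}y\cdots x^{k_m-1}y)=\sum_{n_1>\dots>n_m>0}\frac1{n_1^{k_1}\cdots n_m^{k_m}}\qquad(k_1\ge2,\ k_2,\dots,k_m\ge1).$$ For $z\in\mathbb C\setminus((-\infty,0]\cup[1,\infty))$ define $\mathrm{Li}(\,\cdot\,;z)$ linearly on $\mathfrak h^1$ by $\mathrm{Li}(1;z)=1$ and the iterated integrals $$\mathrm{Li}(xw;z)=\int_0^z\mathrm{Li}(w;s)\frac{ds}{s}\quad(w\in\mathfrak h^1\text{ a nonempty word}),\qquad \mathrm{Li}(yw;z)=\int_0^z\mathrm{Li}(w;s)\frac{ds}{1-s}\quad(w\in\mathfrak h^1\text{ a word})$$ along the straight segment from $0$ to $z$ (so $\mathrm{Li}(x^{k_1-1}y\cdots x^{k_m-1}y;z)=\sum_{n_1>\dots>n_m>0}\frac{z^{n_1}}{n_1^{k_1}\cdots n_m^{k_m}}$ for $|z|<1$), and extend it to $\mathfrak h$ as the shuffle homomorphism with $\mathrm{Li}(x;z)=\log z$ (principal value), that is, $\mathrm{Li}\bigl(\sum_n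 c_n\mathbin{\sqcup\!\sqcup} x^{\mathbin{\sqcup\!\sqcup} n};z\bigr)=\sum_n\mathrm{Li}(c_n;z)(\log z)^n$ for $c_n\in\mathfrak h^1$. Let $\tau$ be the anti-involution of $\mathbb C\langle x,y\rangle$ (for concatenation) with $x\mapsto y$, $y\mapsto x$. **Proposition (Euler connection formula for multiple polylogarithms).** For every word $w$ in $x,y$ and every $z\in\mathbb C\setminus((-\infty,0]\cup[1,\infty))$, $$\sum_{w_1w_2=w}\mathrm{Li}(\tau(w_1);1-z)\,\mathrm{Li}(w_2;z)=\widehat\zeta(\mathrm{reg}(w)),$$ where the sum is over all factorizations of $w$ into two (possibly empty) words. -/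

import Mathlib

namespace MPL

/-- The two letters. -/
inductive Letter
  | x
  | y

/-- Words in the letters `x`, `y`, i.e. the monomials of `ℂ⟨x, y⟩`; the empty word is `1`. -/
abbrev Word := List Letter

/-- The vector space `𝔥 = ℂ⟨x, y⟩`, with the words as basis. -/
abbrev H := Word →₀ ℂ

/-- A word, regarded as an element of `𝔥`. -/
noncomputable def word (w : Word) : H := Finsupp.single w 1

/-- Left concatenation with a letter, `w ↦ a w`, extended linearly. -/
noncomputable def cons (a : Letter) : H →ₗ[ℂ] H := Finsupp.lmapDomain ℂ ℂ (List.cons a)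

/-! ### The shuffle product -/

/-- The shuffle product of two words. -/
noncomputable def shuffleWord : Word → Word → H
  | [], v => word v
  | a :: u, [] => word (a :: u)
  | a :: u, b :: v => cons a (shuffleWord u (b :: v)) + cons b (shuffleWord (a :: u) v)
  termination_by u v => u.length + v.length

/-- The shuffle product on `𝔥`, the bilinear extension of `shuffleWord`. -/
noncomputable def shuffle : H →ₗ[ℂ] H →ₗ[ℂ] H :=
  Finsupp.linearCombination ℂ fun u => Finsupp.linearCombination ℂ fun v => shuffleWord u v

/-- The powers `f ⧢ ⋯ ⧢ f` with respect to the shuffle product. -/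
noncomputable def shufflePow (f : H) : ℕ → H
  | 0 => word []
  | n + 1 => shuffle (shufflePow f n) f

/-- `𝔥¹ = ℂ 1 ⊕ 𝔥 y`. -/
noncomputable def h1 : Submodule ℂ H :=
  Finsupp.supported ℂ ℂ {w : Word | w = [] ∨ ∃ u : Word, w = u ++ [Letter.y]}

/-- `𝔥⁰ = ℂ 1 ⊕ x 𝔥 y`. -/
noncomputable def h0 : Submodule ℂ H :=
  Finsupp.supported ℂ ℂ {w : Word | w = [] ∨ ∃ u : Word, w = Letter.x :: (u ++ [Letter.y])}

/-- The map `𝔥¹[x] → 𝔥`, sending `(c_n)_n` to `∑_n c_n ⧢ x^{⧢ n}`. -/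
noncomputable def sumX : (ℕ →₀ h1) →ₗ[ℂ] H :=
  Finsupp.lsum ℂ fun n => (shuffle.flip (shufflePow (word [Letter.x]) n)) ∘ₗ h1.subtype

/-- The map `𝔥⁰[x, y] → 𝔥`, sending `(c_{m,n})` to `∑_{m,n} y^{⧢ m} ⧢ c_{m,n} ⧢ x^{⧢ n}`. -/
noncomputable def sumYX : (ℕ × ℕ →₀ h0) →ₗ[ℂ] H :=
  Finsupp.lsum ℂ fun p => (shuffle (shufflePow (word [Letter.y]) p.1)) ∘ₗ
    (shuffle.flip (shufflePow (word [Letter.x]) p.2)) ∘ₗ h0.subtype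

/-! ### Both maps are bijective: `𝔥 = 𝔥¹[x] = 𝔥⁰[x, y]` -/

/-- Removal of a final letter `x` (words not ending in `x` go to `0`). -/
noncomputable def dR : H →ₗ[ℂ] H :=
  Finsupp.lcomapDomain (fun u : Word => u ++ [Letter.x]) (List.append_left_injective _)

/-- Removal of an initial letter `y` (words not starting with `y` go to `0`). -/
noncomputable def dL : H →ₗ[ℂ] H :=
  Finsupp.lcomapDomain (fun u : Word => Letter.y :: u) (List.cons_injective)

theorem dR_apply (f : H) (u : Word) : dR f u = f (u ++ [Letter.x]) := rfl

theorem dL_apply (f : H) (u : Word) : dL f u = f (Letter.y :: u) := rfl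

theorem cons_apply_nil (a : Letter) (f : H) : cons a f [] = 0 :=
  Finsupp.mapDomain_of_notMem_range _ _ (by simp)

theorem cons_apply_same (a : Letter) (f : H) (u : Word) : cons a f (a :: u) = f u :=
  Finsupp.mapDomain_apply List.cons_injective _ _

theorem cons_apply_ne {a b : Letter} (h : a ≠ b) (f : H) (u : Word) : cons a f (b :: u) = 0 :=
  Finsupp.mapDomain_of_notMem_range _ _ (by simp [h])

theorem cons_word (a : Letter) (u : Word) : cons a (word u) = word (a :: u) := by
  simp [cons, word]

theorem word_nil_cons (b : Letter) (u : Word) : word [] (b :: u) = 0 := by simp [word]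

theorem word_nil_append (u : Word) (b : Letter) : word [] (u ++ [b]) = 0 := by simp [word]

theorem word_nil_nil : word [] [] = 1 := by simp [word]

theorem dL_cons_y (f : H) : dL (cons Letter.y f) = f := by
  ext u; rw [dL_apply, cons_apply_same]

theorem dL_cons_x (f : H) : dL (cons Letter.x f) = 0 := by
  ext u; rw [dL_apply, cons_apply_ne (by simp)]; rfl

theorem dL_nil : dL (word []) = 0 := by
  ext u; rw [dL_apply, word_nil_cons]; rfl

theorem dR_nil : dR (word []) = 0 := by
  ext u; rw [dR_apply, word_nil_append]; rfl

theorem dR_cons_y (f : H) : dR (cons Letter.y f) = cons Letter.y (dR f) := by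
  ext u
  rw [dR_apply]
  rcases u with _ | ⟨_ | _, u⟩
  · rw [List.nil_append, cons_apply_ne (by simp), cons_apply_nil]
  · rw [List.cons_append, cons_apply_ne (by simp), cons_apply_ne (by simp)]
  · rw [List.cons_append, cons_apply_same, cons_apply_same, dR_apply]

theorem dR_cons_x (f : H) :
    dR (cons Letter.x f) = cons Letter.x (dR f) + (f []) • word [] := by
  ext u
  rw [dR_apply, Finsupp.add_apply, Finsupp.smul_apply]
  rcases u with _ | ⟨_ | _, u⟩
  · rw [List.nil_append, cons_apply_same, cons_apply_nil, word_nil_nil]; simp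
  · rw [List.cons_append, cons_apply_same, cons_apply_same, dR_apply, word_nil_cons]; simp
  · rw [List.cons_append, cons_apply_ne (by simp), cons_apply_ne (by simp), word_nil_cons]; simp

theorem shuffle_word (u v : Word) : shuffle (word u) (word v) = shuffleWord u v := by
  simp [shuffle, word]

theorem word_ext {M : Type*} [AddCommMonoid M] [Module ℂ M] {F G : H →ₗ[ℂ] M}
    (h : ∀ w, F (word w) = G (word w)) : F = G :=
  Finsupp.lhom_ext' fun w => LinearMap.ext_ring (h w)

theorem word_ext₂ {F G : H →ₗ[ℂ] H →ₗ[ℂ] H}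
    (h : ∀ u v, F (word u) (word v) = G (word u) (word v)) : F = G :=
  word_ext fun u => word_ext fun v => h u v

theorem nil_shuffle (f : H) : shuffle (word []) f = f := by
  have : shuffle (word []) = LinearMap.id := word_ext fun w => by
    rw [shuffle_word, shuffleWord]; rfl
  rw [this]; rfl

theorem shuffle_nil (f : H) : shuffle f (word []) = f := by
  have : shuffle.flip (word []) = LinearMap.id := word_ext fun w => by
    rw [LinearMap.flip_apply, shuffle_word]
    cases w <;> rw [shuffleWord] <;> rfl
  exact congrArg (fun F : H →ₗ[ℂ] H => F f) this

theorem cons_shuffle_cons (a b : Letter) (f g : H) :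
    shuffle (cons a f) (cons b g) =
      cons a (shuffle f (cons b g)) + cons b (shuffle (cons a f) g) := by
  have : (shuffle.compl₂ (cons b)) ∘ₗ cons a =
      (shuffle.compl₂ (cons b)).compr₂ (cons a) + (shuffle ∘ₗ cons a).compr₂ (cons b) :=
    word_ext₂ fun u v => by
      simp only [LinearMap.compl₂_apply, LinearMap.comp_apply, LinearMap.add_apply,
        LinearMap.compr₂_apply, cons_word, shuffle_word]
      rw [shuffleWord]
  exact congrArg (fun F : H →ₗ[ℂ] H →ₗ[ℂ] H => F f g) this

theorem word_cases (P : Word → Word → Prop) (h₁ : ∀ v, P [] v) (h₂ : ∀ u, P u [])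
    (h₃ : ∀ a u b v, P u (b :: v) → P (a :: u) v → P (a :: u) (b :: v)) : ∀ u v, P u v
  | [], v => h₁ v
  | a :: u, [] => h₂ _
  | a :: u, b :: v => h₃ a u b v (word_cases P h₁ h₂ h₃ u (b :: v))
      (word_cases P h₁ h₂ h₃ (a :: u) v)
  termination_by u v => u.length + v.length

theorem dL_shuffle (f g : H) :
    dL (shuffle f g) = shuffle (dL f) g + shuffle f (dL g) := by
  have : shuffle.compr₂ dL = shuffle ∘ₗ dL + shuffle.compl₂ dL := by
    refine word_ext₂ (word_cases _ ?_ ?_ ?_)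
    · intro v
      simp [nil_shuffle, dL_nil]
    · intro u
      simp [shuffle_nil, dL_nil]
    · intro a u b v _ _
      simp only [LinearMap.compl₂_apply, LinearMap.comp_apply, LinearMap.add_apply,
        LinearMap.compr₂_apply, ← cons_word, cons_shuffle_cons, map_add]
      cases a <;> cases b <;> simp [dL_cons_x, dL_cons_y]
  exact congrArg (fun F : H →ₗ[ℂ] H →ₗ[ℂ] H => F f g) this

theorem shuffle_cons_apply_nil (f : H) (b : Letter) (g : H) :
    shuffle f (cons b g) [] = 0 := by
  have : (Finsupp.lapply []) ∘ₗ (shuffle.flip (cons b g)) = (0 : H →ₗ[ℂ] ℂ) :=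
    word_ext fun w => by
      rcases w with _ | ⟨a, w⟩
      · simp [nil_shuffle, cons_apply_nil]
      · simp [← cons_word, cons_shuffle_cons, cons_apply_nil]
  exact congrArg (fun F : H →ₗ[ℂ] ℂ => F f) this

theorem cons_shuffle_apply_nil (f : H) (b : Letter) (g : H) :
    shuffle (cons b g) f [] = 0 := by
  have : (Finsupp.lapply []) ∘ₗ (shuffle (cons b g)) = (0 : H →ₗ[ℂ] ℂ) :=
    word_ext fun w => by
      rcases w with _ | ⟨a, w⟩
      · simp [shuffle_nil, cons_apply_nil]
      · simp [← cons_word, cons_shuffle_cons, cons_apply_nil]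
  exact congrArg (fun F : H →ₗ[ℂ] ℂ => F f) this

theorem dR_shuffle (f g : H) :
    dR (shuffle f g) = shuffle (dR f) g + shuffle f (dR g) := by
  have : shuffle.compr₂ dR = shuffle ∘ₗ dR + shuffle.compl₂ dR := by
    refine word_ext₂ (word_cases _ ?_ ?_ ?_)
    · intro v
      simp [nil_shuffle, dR_nil]
    · intro u
      simp [shuffle_nil, dR_nil]
    · intro a u b v h₁ h₂
      simp only [LinearMap.compl₂_apply, LinearMap.comp_apply, LinearMap.add_apply,
        LinearMap.compr₂_apply, ← cons_word] at h₁ h₂ ⊢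
      cases a <;> cases b <;>
      · simp only [cons_shuffle_cons, map_add, dR_cons_x, dR_cons_y, h₁, h₂, LinearMap.add_apply,
          shuffle_cons_apply_nil, cons_shuffle_apply_nil, zero_smul, add_zero, map_smul,
          LinearMap.smul_apply, nil_shuffle, shuffle_nil]
        abel
  exact congrArg (fun F : H →ₗ[ℂ] H →ₗ[ℂ] H => F f g) this

theorem mem_h1 (f : H) : f ∈ h1 ↔ dR f = 0 := by
  rw [h1, Finsupp.mem_supported']
  constructor
  · intro h
    ext u
    rw [dR_apply]
    refine h _ ?_
    rintro (h | ⟨v, h⟩)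
    · simp at h
    · have := (List.append_inj' h rfl).2
      simp at this
  · intro h w hw
    rcases List.eq_nil_or_concat w with rfl | ⟨u, a, rfl⟩
    · simp at hw
    · cases a
      · rw [List.concat_eq_append, ← dR_apply, h]; rfl
      · simp at hw

theorem mem_h0 (f : H) : f ∈ h0 ↔ dL f = 0 ∧ dR f = 0 := by
  rw [h0, Finsupp.mem_supported']
  constructor
  · intro h
    constructor
    · ext u
      exact h _ (by simp)
    · ext u
      refine h _ ?_
      rcases u with _ | ⟨a, u⟩ <;> simp
  · rintro ⟨hl, hr⟩ w hw
    rcases w with _ | ⟨a, w⟩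
    · simp at hw
    · cases a
      · rcases List.eq_nil_or_concat w with rfl | ⟨u, a, rfl⟩
        · exact (dR_apply f []).symm.trans (by rw [hr]; rfl)
        · cases a
          · rw [List.concat_eq_append, ← List.cons_append, ← dR_apply, hr]; rfl
          · simp at hw
      · rw [← dL_apply, hl]; rfl

theorem dL_nilpotent (N : ℕ) (f : H) (h : ∀ u, N ≤ u.length → f u = 0) : (dL ^ N) f = 0 := by
  induction N generalizing f with
  | zero => ext u; exact h u (Nat.zero_le _)
  | succ N ih =>
    rw [pow_succ]
    exact ih _ fun u hu => h _ (by simpa using hu)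

theorem dR_nilpotent (N : ℕ) (f : H) (h : ∀ u, N ≤ u.length → f u = 0) : (dR ^ N) f = 0 := by
  induction N generalizing f with
  | zero => ext u; exact h u (Nat.zero_le _)
  | succ N ih =>
    rw [pow_succ]
    exact ih _ fun u hu => h _ (by simpa using hu)

theorem exists_length_bound (f : H) : ∃ N, ∀ u : Word, N ≤ u.length → f u = 0 := by
  refine ⟨f.support.sup List.length + 1, fun u hu => ?_⟩
  by_contra hne
  have := Finset.le_sup (f := List.length) (Finsupp.mem_support_iff.mpr hne)
  omega

/-- `D` behaves like `d/dT` for the operators `P n`, "multiplication by `T ^ n`". -/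
structure IsSlice (D : H →ₗ[ℂ] H) (P : ℕ → H →ₗ[ℂ] H) : Prop where
  zero : ∀ f, P 0 f = f
  succ : ∀ n f, D (P (n + 1) f) = P (n + 1) (D f) + ((n : ℂ) + 1) • P n f

theorem IsSlice.exists_sum {D : H →ₗ[ℂ] H} {P : ℕ → H →ₗ[ℂ] H} (hP : IsSlice D P)
    (K : Submodule ℂ H) (hD : ∀ f ∈ K, D f ∈ K) (hK : ∀ n, ∀ f ∈ K, P n f ∈ K) (N : ℕ) :
    ∀ f ∈ K, (D ^ N) f = 0 → ∃ c : ℕ → H, (∀ n, c n ∈ K ∧ D (c n) = 0) ∧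
      f = ∑ n ∈ Finset.range N, P n (c n) := by
  induction N with
  | zero =>
    intro f _ h
    exact ⟨fun _ => 0, by simp, by simpa using h⟩
  | succ N ih =>
    intro f hf h
    obtain ⟨c, hc, hs⟩ := ih (D f) (hD f hf) (by rw [pow_succ] at h; exact h)
    set g : H := ∑ n ∈ Finset.range N, P (n + 1) (((n : ℂ) + 1)⁻¹ • c n) with hg
    have hgK : g ∈ K := K.sum_mem fun n _ => hK _ _ (K.smul_mem _ (hc n).1)
    have hDg : D g = D f := by
      rw [hs, hg, map_sum]
      refine Finset.sum_congr rfl fun n _ => ?_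
      have : ((n : ℂ) + 1) ≠ 0 := by exact_mod_cast Nat.succ_ne_zero n
      rw [hP.succ, map_smul, (hc n).2, smul_zero, map_zero, zero_add, map_smul, smul_smul,
        mul_inv_cancel₀ this, one_smul]
    refine ⟨fun n => Nat.casesOn n (f - g) fun n => ((n : ℂ) + 1)⁻¹ • c n, ?_, ?_⟩
    · rintro (_ | n)
      · exact ⟨K.sub_mem hf hgK, by simp [hDg]⟩
      · exact ⟨K.smul_mem _ (hc n).1, by simp [(hc n).2]⟩
    · rw [Finset.sum_range_succ']
      simp only [hP.zero]
      rw [← hg]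
      exact (add_sub_cancel g f).symm

theorem IsSlice.eq_zero {D : H →ₗ[ℂ] H} {P : ℕ → H →ₗ[ℂ] H} (hP : IsSlice D P) (N : ℕ) :
    ∀ c : ℕ → H, (∀ n, D (c n) = 0) → ∑ n ∈ Finset.range N, P n (c n) = 0 →
      ∀ n < N, c n = 0 := by
  induction N with
  | zero => intro c _ _ n hn; omega
  | succ N ih =>
    intro c hc hs
    have key : ∀ n < N, c (n + 1) = 0 := by
      have h' : ∑ n ∈ Finset.range N, P n (((n : ℂ) + 1) • c (n + 1)) = 0 := by
        have := congrArg D hs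
        rw [Finset.sum_range_succ', map_add, hP.zero, hc 0, add_zero, map_zero, map_sum] at this
        rw [← this]
        refine Finset.sum_congr rfl fun n _ => ?_
        rw [hP.succ, hc, map_zero, zero_add, map_smul]
      intro n hn
      have := ih (fun n => ((n : ℂ) + 1) • c (n + 1)) (fun n => by simp [hc]) h' n hn
      have hne : ((n : ℂ) + 1) ≠ 0 := by exact_mod_cast Nat.succ_ne_zero n
      exact (smul_eq_zero.mp this).resolve_left hne
    rintro (_ | n) hn
    · rw [Finset.sum_range_succ', hP.zero, Finset.sum_eq_zero, zero_add] at hs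
      · exact hs
      · intro n hn
        rw [key n (Finset.mem_range.mp hn), map_zero]
    · exact key n (by omega)

theorem dR_word_x : dR (word [Letter.x]) = word [] := by
  rw [← cons_word, dR_cons_x, dR_nil, word_nil_nil]; simp

theorem dL_word_x : dL (word [Letter.x]) = 0 := by
  rw [← cons_word, dL_cons_x]

theorem dL_word_y : dL (word [Letter.y]) = word [] := by
  rw [← cons_word, dL_cons_y]

theorem dR_pow_x (n : ℕ) : dR (shufflePow (word [Letter.x]) (n + 1)) =
    ((n : ℂ) + 1) • shufflePow (word [Letter.x]) n := by
  induction n with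
  | zero => simp [shufflePow, nil_shuffle, dR_word_x]
  | succ n ih =>
    rw [shufflePow, dR_shuffle, ih, dR_word_x, shuffle_nil, map_smul, LinearMap.smul_apply,
      ← shufflePow]
    push_cast
    rw [add_smul ((n : ℂ) + 1) 1, one_smul]

theorem dL_pow_y (n : ℕ) : dL (shufflePow (word [Letter.y]) (n + 1)) =
    ((n : ℂ) + 1) • shufflePow (word [Letter.y]) n := by
  induction n with
  | zero => simp [shufflePow, nil_shuffle, dL_word_y]
  | succ n ih =>
    rw [shufflePow, dL_shuffle, ih, dL_word_y, shuffle_nil, map_smul, LinearMap.smul_apply,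
      ← shufflePow]
    push_cast
    rw [add_smul ((n : ℂ) + 1) 1, one_smul]

theorem dL_pow_x (n : ℕ) : dL (shufflePow (word [Letter.x]) n) = 0 := by
  induction n with
  | zero => exact dL_nil
  | succ n ih => rw [shufflePow, dL_shuffle, ih, dL_word_x]; simp

theorem isSliceX : IsSlice dR fun n => shuffle.flip (shufflePow (word [Letter.x]) n) where
  zero f := shuffle_nil f
  succ n f := by
    simp only [LinearMap.flip_apply]
    rw [dR_shuffle, dR_pow_x, map_smul]

theorem isSliceY : IsSlice dL fun n => shuffle (shufflePow (word [Letter.y]) n) where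
  zero f := nil_shuffle f
  succ n f := by
    rw [dL_shuffle, dL_pow_y, map_smul, LinearMap.smul_apply, add_comm]

theorem dL_dR (f : H) : dL (dR f) = dR (dL f) := by
  ext u
  rw [dL_apply, dR_apply, dR_apply, dL_apply, List.cons_append]

theorem sumX_eq (c : ℕ →₀ h1) (N : ℕ) (hN : c.support ⊆ Finset.range N) :
    sumX c = ∑ n ∈ Finset.range N,
      shuffle.flip (shufflePow (word [Letter.x]) n) (c n : H) := by
  rw [sumX, Finsupp.lsum_apply, Finsupp.sum_of_support_subset _ hN _ (by simp)]
  rfl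

theorem sumX_bijective : Function.Bijective sumX := by
  constructor
  · intro c e hce
    obtain ⟨N, hN⟩ := (c.support ∪ e.support).exists_nat_subset_range
    rw [sumX_eq c N (Finset.union_subset_left hN), sumX_eq e N (Finset.union_subset_right hN),
      ← sub_eq_zero, ← Finset.sum_sub_distrib] at hce
    simp only [← map_sub] at hce
    have := isSliceX.eq_zero N (fun n => (c n : H) - e n) (fun n => by
      rw [map_sub, (mem_h1 _).mp (c n).2, (mem_h1 _).mp (e n).2, sub_zero]) hce
    ext1 n
    by_cases hn : n < N
    · exact Subtype.ext (sub_eq_zero.mp (this n hn))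
    · have hn' : n ∉ c.support ∪ e.support := fun h => hn (Finset.mem_range.mp (hN h))
      rw [Finset.mem_union, not_or] at hn'
      rw [Finsupp.notMem_support_iff.mp hn'.1, Finsupp.notMem_support_iff.mp hn'.2]
  · intro f
    obtain ⟨N, hN⟩ := exists_length_bound f
    obtain ⟨c, hc, hs⟩ := isSliceX.exists_sum ⊤ (by simp) (by simp) N f trivial
      (dR_nilpotent N f hN)
    refine ⟨∑ n ∈ Finset.range N, Finsupp.single n ⟨c n, (mem_h1 _).mpr (hc n).2⟩, ?_⟩
    rw [map_sum, hs]
    refine Finset.sum_congr rfl fun n _ => ?_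
    simp [sumX]

theorem sumYX_eq (c : ℕ × ℕ →₀ h0) (N : ℕ)
    (hN : c.support ⊆ Finset.range N ×ˢ Finset.range N) :
    sumYX c = ∑ m ∈ Finset.range N, shuffle (shufflePow (word [Letter.y]) m)
      (∑ n ∈ Finset.range N,
        shuffle.flip (shufflePow (word [Letter.x]) n) (c (m, n) : H)) := by
  rw [sumYX, Finsupp.lsum_apply, Finsupp.sum_of_support_subset _ hN _ (by simp),
    Finset.sum_product]
  simp only [map_sum]
  rfl

theorem sumYX_bijective : Function.Bijective sumYX := by
  have hPx : ∀ n, ∀ f ∈ LinearMap.ker dL,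
      shuffle.flip (shufflePow (word [Letter.x]) n) f ∈ LinearMap.ker dL := by
    intro n f hf
    rw [LinearMap.mem_ker] at hf ⊢
    rw [LinearMap.flip_apply, dL_shuffle, hf, dL_pow_x]; simp
  constructor
  · intro c e hce
    obtain ⟨N, hN⟩ : ∃ N, c.support ∪ e.support ⊆ Finset.range N ×ˢ Finset.range N := by
      obtain ⟨A, hA⟩ := ((c.support ∪ e.support).image Prod.fst).exists_nat_subset_range
      obtain ⟨B, hB⟩ := ((c.support ∪ e.support).image Prod.snd).exists_nat_subset_range
      refine ⟨max A B, fun p hp => ?_⟩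
      have h1 := Finset.mem_range.mp (hA (Finset.mem_image_of_mem Prod.fst hp))
      have h2 := Finset.mem_range.mp (hB (Finset.mem_image_of_mem Prod.snd hp))
      simp only [Finset.mem_product, Finset.mem_range]
      omega
    rw [sumYX_eq c N (Finset.union_subset_left hN), sumYX_eq e N (Finset.union_subset_right hN),
      ← sub_eq_zero, ← Finset.sum_sub_distrib] at hce
    simp only [← map_sub, ← Finset.sum_sub_distrib] at hce
    have hdL : ∀ p, dL ((c p : H) - e p) = 0 := fun p => by
      rw [map_sub, ((mem_h0 _).mp (c p).2).1, ((mem_h0 _).mp (e p).2).1, sub_zero]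
    have hdR : ∀ p, dR ((c p : H) - e p) = 0 := fun p => by
      rw [map_sub, ((mem_h0 _).mp (c p).2).2, ((mem_h0 _).mp (e p).2).2, sub_zero]
    have h₁ := isSliceY.eq_zero N _ (fun m => LinearMap.mem_ker.mp <|
      Submodule.sum_mem _ fun n _ => hPx n _ (hdL (m, n))) hce
    ext1 ⟨m, n⟩
    by_cases hmn : m < N ∧ n < N
    · exact Subtype.ext (sub_eq_zero.mp (isSliceX.eq_zero N (fun n => (c (m, n) : H) - e (m, n))
        (fun n => hdR (m, n)) (h₁ m hmn.1) n hmn.2))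
    · have hn' : (m, n) ∉ c.support ∪ e.support := fun h => by
        have := hN h
        simp only [Finset.mem_product, Finset.mem_range] at this
        exact hmn this
      rw [Finset.mem_union, not_or] at hn'
      rw [Finsupp.notMem_support_iff.mp hn'.1, Finsupp.notMem_support_iff.mp hn'.2]
  · intro f
    obtain ⟨N, hN⟩ := exists_length_bound f
    obtain ⟨d, hd, hs⟩ := isSliceY.exists_sum ⊤ (by simp) (by simp) N f trivial
      (dL_nilpotent N f hN)
    have hex : ∀ m, ∃ a : ℕ →₀ h0, d m = a.sum fun n u =>
        shuffle.flip (shufflePow (word [Letter.x]) n) (u : H) := by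
      intro m
      obtain ⟨M, hM⟩ := exists_length_bound (d m)
      obtain ⟨c, hc, hs⟩ := isSliceX.exists_sum (LinearMap.ker dL)
        (fun f hf => by
          rw [LinearMap.mem_ker] at hf ⊢
          rw [dL_dR, hf, map_zero]) hPx M (d m) (hd m).2 (dR_nilpotent M _ hM)
      refine ⟨∑ n ∈ Finset.range M, Finsupp.single n ⟨c n, (mem_h0 _).mpr (hc n)⟩, ?_⟩
      rw [← Finsupp.sum_finsetSum_index (by simp) (by simp), hs]
      refine Finset.sum_congr rfl fun n _ => ?_
      simp
    choose a ha using hex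
    refine ⟨∑ m ∈ Finset.range N, (a m).mapDomain (Prod.mk m), ?_⟩
    rw [map_sum, hs]
    refine Finset.sum_congr rfl fun m _ => ?_
    rw [sumYX, Finsupp.lsum_apply, Finsupp.sum_mapDomain_index (by simp) (by simp), ha m,
      Finsupp.sum, Finsupp.sum, map_sum]
    rfl

/-- The decomposition `𝔥 = ⨁_n 𝔥¹ ⧢ x^{⧢ n} = 𝔥¹[x]`. -/
noncomputable def decompX : (ℕ →₀ h1) ≃ₗ[ℂ] H := LinearEquiv.ofBijective sumX sumX_bijective

/-- The decomposition `𝔥 = ⨁_{m,n} y^{⧢ m} ⧢ 𝔥⁰ ⧢ x^{⧢ n} = 𝔥⁰[x, y]`. -/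
noncomputable def decompYX : (ℕ × ℕ →₀ h0) ≃ₗ[ℂ] H :=
  LinearEquiv.ofBijective sumYX sumYX_bijective

/-- Shuffle regularization: the constant term in the decomposition `𝔥 = 𝔥⁰[x, y]`. -/
noncomputable def reg (f : H) : h0 := decompYX.symm f (0, 0)

/-! ### Multiple zeta values -/

/-- Auxiliary: `x^{k₁-1} y ⋯ x^{k_m-1} y` preceded by `x^{j-1}`, read off as
`[k₁ + j - 1, k₂, …, k_m]`. -/
def exponentsAux : ℕ → Word → List ℕ
  | _, [] => []
  | j, Letter.x :: w => exponentsAux (j + 1) w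
  | j, Letter.y :: w => j :: exponentsAux 1 w

/-- The list `[k₁, …, k_m]` of a word `x^{k₁-1} y ⋯ x^{k_m-1} y`. -/
def exponents (w : Word) : List ℕ := exponentsAux 1 w

/-- `ζ(k₁, …, k_m) = ∑_{n₁ > ⋯ > n_m > 0} 1 / (n₁^{k₁} ⋯ n_m^{k_m})`. -/
noncomputable def mzv (k : List ℕ) : ℂ :=
  ∑' n : {n : Fin k.length → ℕ // StrictAnti n ∧ ∀ i, 0 < n i},
    1 / ∏ i, ((n.1 i : ℂ) ^ k.get i)

/-- The linear map `ζ̂ : 𝔥⁰ → ℂ`, `x^{k₁-1} y ⋯ x^{k_m-1} y ↦ ζ(k₁, …, k_m)`. -/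
noncomputable def zetaHat : h0 →ₗ[ℂ] ℂ :=
  (Finsupp.linearCombination ℂ fun w => mzv (exponents w)) ∘ₗ h0.subtype

/-! ### Multiple polylogarithms -/

/-- `∫_0^z f(s) ds` along the straight segment from `0` to `z`. -/
noncomputable def integralFromZero (f : ℂ → ℂ) (z : ℂ) : ℂ :=
  ∫ t in (0 : ℝ)..1, f (t * z) * z

/-- The iterated integral, from `0`, attached to a word of `𝔥¹` by `x ↔ ds / s` and
`y ↔ ds / (1 - s)`, the leftmost letter being the outermost integration. -/
noncomputable def LiWord : Word → ℂ → ℂ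
  | [], _ => 1
  | Letter.x :: w, z => integralFromZero (fun s => LiWord w s / s) z
  | Letter.y :: w, z => integralFromZero (fun s => LiWord w s / (1 - s)) z

/-- `Li(f; z)` for `f ∈ 𝔥¹`, by linearity. -/
noncomputable def LiOne (f : h1) (z : ℂ) : ℂ :=
  Finsupp.linearCombination ℂ (fun w => LiWord w z) (f : H)

/-- `Li(f; z)` for `f ∈ 𝔥`: the extension of `Li(·; z)` from `𝔥¹` to `𝔥 = 𝔥¹[x]` by
`Li(x; z) = log z` (principal value), i.e.
`Li(∑_n c_n ⧢ x^{⧢ n}; z) = ∑_n Li(c_n; z) (log z)^n`. -/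
noncomputable def Li (f : H) (z : ℂ) : ℂ :=
  (decompX.symm f).sum fun n c => LiOne c z * Complex.log z ^ n

/-- The domain `ℂ \ ((-∞, 0] ∪ [1, ∞))`. -/
def cutPlane : Set ℂ := {z | ∀ r : ℝ, r ≤ 0 ∨ 1 ≤ r → z ≠ (r : ℂ)}

/-- The exchange of the letters `x` and `y`. -/
def swap : Letter → Letter
  | Letter.x => Letter.y
  | Letter.y => Letter.x

/-- The anti-involution `τ` with `x ↦ y`, `y ↦ x`, on words: reverse and exchange letters. -/
def tau (w : Word) : Word := (w.map swap).reverse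

end MPL

namespace MPL

/-! ### The algebra of the shuffle product -/

/-! Call the left-hand side `connection z`, extended linearly in the word. Three facts determine it.

It is a shuffle character. The functionals `Li(·; z)` and `Li(τ(·); 1 - z)` are multiplicative for
the shuffle product, and `connection z` is their convolution along deconcatenation. Deconcatenation
is a morphism of shuffle algebras (`deconcat_shuffle`), so the convolution is again multiplicative.
Multiplicativity of `Li` on `𝔥¹` comes from uniqueness for a differential equation
(`LiOneLinear_shuffle_word`), and it extends to `𝔥 = 𝔥¹[x]`.

It does not depend on `z`. Differentiating `Li` strips the first letter; after `τ` and `z ↦ 1 - z`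
it strips the last letter of the prefix, with the opposite sign. The derivative of the sum therefore
telescopes to zero (`hasDerivAt_connection`), and the cut plane is connected.

Its values on generators are limits as `z → 1⁻`. On the letter `x` the limit is `0`, and on `y` it
is `0` by the symmetry `z ↔ 1 - z`. On a word of `x𝔥y` every term with nonempty prefix tends to `0`,
because `Li(τ(w₁); 1 - t) = O(1 - t)` while `(1 - t) Li(w₂; t) → 0`; the remaining term tends to the
multiple zeta value by Abel's theorem.

A character killing `x` and `y` sees only the constant term of an element in `𝔥⁰[x, y]`, that is,
its regularization (`eq_comp_reg`). -/

theorem shuffle_comm (f g : H) : shuffle f g = shuffle g f := by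
  have : shuffle = shuffle.flip := by
    refine word_ext₂ (word_cases _ ?_ ?_ ?_)
    · intro v
      simp [nil_shuffle, shuffle_nil]
    · intro u
      simp [nil_shuffle, shuffle_nil]
    · intro a u b v h₁ h₂
      simp only [← cons_word, LinearMap.flip_apply] at h₁ h₂ ⊢
      rw [cons_shuffle_cons, cons_shuffle_cons, h₁, h₂, add_comm]
  exact congrArg (fun F : H →ₗ[ℂ] H →ₗ[ℂ] H => F f g) this

theorem shuffle_assoc_word : ∀ u v w : Word, shuffle (shuffle (word u) (word v)) (word w) =
    shuffle (word u) (shuffle (word v) (word w))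
  | [], v, w => by rw [nil_shuffle, nil_shuffle]
  | a :: u, [], w => by rw [nil_shuffle, shuffle_nil]
  | a :: u, b :: v, [] => by rw [shuffle_nil, shuffle_nil]
  | a :: u, b :: v, c :: w => by
    have h₁ := shuffle_assoc_word u (b :: v) (c :: w)
    have h₂ := shuffle_assoc_word (a :: u) v (c :: w)
    have h₃ := shuffle_assoc_word (a :: u) (b :: v) w
    simp only [← cons_word, cons_shuffle_cons, map_add, LinearMap.add_apply] at h₁ h₂ h₃ ⊢
    -- `h₃` is used backwards: the words starting with `c` form one term on the right but two on the
    -- left.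
    rw [h₁, h₂, ← h₃]
    simp only [map_add]
    abel
  termination_by u v w => u.length + v.length + w.length

theorem shuffle_assoc (f g h : H) : shuffle (shuffle f g) h = shuffle f (shuffle g h) := by
  have : shuffle.compr₂ shuffle =
      (LinearMap.lcomp ℂ _ shuffle) ∘ₗ (LinearMap.llcomp ℂ H H H) ∘ₗ shuffle :=
    word_ext fun u => word_ext fun v => word_ext fun w => shuffle_assoc_word u v w
  exact congrArg (fun F : H →ₗ[ℂ] H →ₗ[ℂ] H →ₗ[ℂ] H => F f g h) this

theorem shufflePow_add (f : H) (m n : ℕ) :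
    shufflePow f (m + n) = shuffle (shufflePow f m) (shufflePow f n) := by
  induction n with
  | zero => exact (shuffle_nil _).symm
  | succ n ih => rw [← add_assoc, shufflePow, ih, shuffle_assoc, ← shufflePow]

theorem shuffle_shufflePow_shuffle (f g p : H) (m n : ℕ) :
    shuffle (shuffle f (shufflePow p m)) (shuffle g (shufflePow p n)) =
      shuffle (shuffle f g) (shufflePow p (m + n)) := by
  rw [shuffle_assoc, shuffle_assoc, shufflePow_add, ← shuffle_assoc (shufflePow p m),
    shuffle_comm (shufflePow p m) g, shuffle_assoc]

/-- Removal of an initial letter `a`. -/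
noncomputable def dropHead (a : Letter) : H →ₗ[ℂ] H :=
  Finsupp.lcomapDomain (fun u : Word => a :: u) List.cons_injective

/-- Removal of a final letter `a`. -/
noncomputable def dropLast (a : Letter) : H →ₗ[ℂ] H :=
  Finsupp.lcomapDomain (fun u : Word => u ++ [a]) (List.append_left_injective _)

theorem dropHead_apply (a : Letter) (f : H) (u : Word) : dropHead a f u = f (a :: u) := rfl

theorem dropLast_apply (a : Letter) (f : H) (u : Word) : dropLast a f u = f (u ++ [a]) := rfl

theorem dropLast_x : dropLast Letter.x = dR := rfl

theorem ext_dropHead {f g : H} (h₀ : f [] = g []) (h : ∀ a, dropHead a f = dropHead a g) :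
    f = g := by
  ext u
  cases u with
  | nil => exact h₀
  | cons a u => exact congrArg (fun F : H => F u) (h a)

theorem dropHead_nil (a : Letter) : dropHead a (word []) = 0 := by
  ext u; rw [dropHead_apply, word_nil_cons]; rfl

theorem dropLast_nil (a : Letter) : dropLast a (word []) = 0 := by
  ext u; rw [dropLast_apply, word_nil_append]; rfl

theorem dropHead_cons_same (a : Letter) (f : H) : dropHead a (cons a f) = f := by
  ext u; rw [dropHead_apply, cons_apply_same]

theorem dropHead_cons_ne {a b : Letter} (h : b ≠ a) (f : H) : dropHead a (cons b f) = 0 := by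
  ext u; rw [dropHead_apply, cons_apply_ne h]; rfl

/-- The first letter of a shuffle comes from one of the two factors. This Leibniz rule mirrors the
product rule, since differentiating `Li` amounts to applying the maps `dropHead`. -/
theorem dropHead_shuffle (a : Letter) (f g : H) :
    dropHead a (shuffle f g) = shuffle (dropHead a f) g + shuffle f (dropHead a g) := by
  have : shuffle.compr₂ (dropHead a) = shuffle ∘ₗ dropHead a + shuffle.compl₂ (dropHead a) := by
    refine word_ext₂ (word_cases _ ?_ ?_ ?_)
    · intro v
      simp [nil_shuffle, dropHead_nil]
    · intro u
      simp [shuffle_nil, dropHead_nil]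
    · intro b u c v _ _
      simp only [LinearMap.compl₂_apply, LinearMap.comp_apply, LinearMap.add_apply,
        LinearMap.compr₂_apply, ← cons_word, cons_shuffle_cons, map_add]
      by_cases hb : b = a <;> by_cases hc : c = a <;>
        simp_all [dropHead_cons_same, dropHead_cons_ne]
  exact congrArg (fun F : H →ₗ[ℂ] H →ₗ[ℂ] H => F f g) this

theorem dropLast_cons_same (a : Letter) (f : H) :
    dropLast a (cons a f) = cons a (dropLast a f) + (f []) • word [] := by
  ext u
  rw [dropLast_apply, Finsupp.add_apply, Finsupp.smul_apply]
  rcases u with _ | ⟨b, u⟩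
  · rw [List.nil_append, cons_apply_same, cons_apply_nil, word_nil_nil]; simp
  · rw [List.cons_append, word_nil_cons]
    by_cases h : a = b
    · subst h
      rw [cons_apply_same, cons_apply_same, dropLast_apply]; simp
    · rw [cons_apply_ne h, cons_apply_ne h]; simp

theorem dropLast_cons_ne {a b : Letter} (h : b ≠ a) (f : H) :
    dropLast a (cons b f) = cons b (dropLast a f) := by
  ext u
  rw [dropLast_apply]
  rcases u with _ | ⟨c, u⟩
  · rw [List.nil_append, cons_apply_ne h, cons_apply_nil]
  · rw [List.cons_append]
    by_cases h' : b = c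
    · subst h'
      rw [cons_apply_same, cons_apply_same, dropLast_apply]
    · rw [cons_apply_ne h', cons_apply_ne h']

/-- The scalar is `1` or `0` according as the letters agree or not; hiding it lets
`dropLast_shuffle` treat all pairs of letters at once. -/
theorem dropLast_cons (a b : Letter) : ∃ r : ℂ, ∀ f : H,
    dropLast a (cons b f) = cons b (dropLast a f) + (r * f []) • word [] := by
  by_cases h : b = a
  · subst h
    exact ⟨1, fun f => by rw [dropLast_cons_same, one_mul]⟩
  · exact ⟨0, fun f => by rw [dropLast_cons_ne h, zero_mul, zero_smul, add_zero]⟩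

/-- The recursion for the shuffle works at the front of the words, so the last letter is reached
only through the correction terms of `dropLast_cons`. Those for the shuffles themselves vanish, a
shuffle with a nonempty word having no constant term. -/
theorem dropLast_shuffle (a : Letter) (f g : H) :
    dropLast a (shuffle f g) = shuffle (dropLast a f) g + shuffle f (dropLast a g) := by
  have : shuffle.compr₂ (dropLast a) = shuffle ∘ₗ dropLast a + shuffle.compl₂ (dropLast a) := by
    refine word_ext₂ (word_cases _ ?_ ?_ ?_)
    · intro v
      simp [nil_shuffle, dropLast_nil]
    · intro u
      simp [shuffle_nil, dropLast_nil]
    · intro b u c v h₁ h₂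
      simp only [LinearMap.compl₂_apply, LinearMap.comp_apply, LinearMap.add_apply,
        LinearMap.compr₂_apply, ← cons_word] at h₁ h₂ ⊢
      obtain ⟨r, hr⟩ := dropLast_cons a b
      obtain ⟨s, hs⟩ := dropLast_cons a c
      simp only [cons_shuffle_cons, map_add, hr, hs, h₁, h₂, LinearMap.add_apply,
        shuffle_cons_apply_nil, cons_shuffle_apply_nil, mul_zero, zero_smul, add_zero, map_smul,
        LinearMap.smul_apply, nil_shuffle, shuffle_nil]
      abel
  exact congrArg (fun F : H →ₗ[ℂ] H →ₗ[ℂ] H => F f g) this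

theorem dropHead_dropLast (a b : Letter) (f : H) :
    dropHead a (dropLast b f) = dropLast b (dropHead a f) := by
  ext u
  rw [dropHead_apply, dropLast_apply, dropLast_apply, dropHead_apply, List.cons_append]

theorem shuffle_apply_nil (f g : H) : shuffle f g [] = f [] * g [] := by
  have : shuffle.compr₂ (Finsupp.lapply []) =
      (LinearMap.mul ℂ ℂ).compl₁₂ (Finsupp.lapply []) (Finsupp.lapply []) := by
    refine word_ext fun u => word_ext fun v => ?_
    rcases u with _ | ⟨a, u⟩
    · simp [nil_shuffle, word_nil_nil]
    · simp [← cons_word, cons_shuffle_apply_nil, cons_apply_nil]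
  exact congrArg (fun F : H →ₗ[ℂ] H →ₗ[ℂ] ℂ => F f g) this

theorem dropHead_mem_h1 (a : Letter) {f : H} (hf : f ∈ h1) : dropHead a f ∈ h1 := by
  rw [mem_h1, ← dropLast_x] at hf ⊢
  rw [← dropHead_dropLast, hf, map_zero]

theorem shuffle_mem_h1 {f g : H} (hf : f ∈ h1) (hg : g ∈ h1) : shuffle f g ∈ h1 := by
  rw [mem_h1] at hf hg ⊢
  rw [dR_shuffle, hf, hg]; simp

theorem dropHead_x_pow_x (n : ℕ) : dropHead Letter.x (shufflePow (word [Letter.x]) (n + 1)) =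
    ((n : ℂ) + 1) • shufflePow (word [Letter.x]) n := by
  have hx : dropHead Letter.x (word [Letter.x]) = word [] := by
    rw [← cons_word, dropHead_cons_same]
  induction n with
  | zero => simp [shufflePow, nil_shuffle, hx]
  | succ n ih =>
    rw [shufflePow, dropHead_shuffle, ih, hx, shuffle_nil, map_smul, LinearMap.smul_apply,
      ← shufflePow]
    push_cast
    rw [add_smul ((n : ℂ) + 1) 1, one_smul]

/-! ### The anti-involution and the shuffle product -/

theorem swap_swap (a : Letter) : swap (swap a) = a := by cases a <;> rfl

theorem tau_tau (w : Word) : tau (tau w) = w := by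
  have : swap ∘ swap = id := funext swap_swap
  simp [tau, this]

theorem tau_concat (w : Word) (a : Letter) : tau (w ++ [a]) = swap a :: tau w := by
  simp [tau]

theorem tau_cons (w : Word) (a : Letter) : tau (a :: w) = tau w ++ [swap a] := by
  simp [tau]

/-- The linear extension of `tau` to `𝔥`. -/
noncomputable def tauLinear : H →ₗ[ℂ] H := Finsupp.lmapDomain ℂ ℂ tau

theorem tauLinear_word (w : Word) : tauLinear (word w) = word (tau w) := by
  simp [tauLinear, word]

theorem tauLinear_apply (f : H) (w : Word) : tauLinear f w = f (tau w) := by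
  conv_lhs => rw [← tau_tau w]
  exact Finsupp.mapDomain_apply (Function.LeftInverse.injective tau_tau) _ _

theorem dropHead_tauLinear (a : Letter) (f : H) :
    dropHead a (tauLinear f) = tauLinear (dropLast (swap a) f) := by
  ext u
  rw [dropHead_apply, tauLinear_apply, tauLinear_apply, dropLast_apply, tau_cons]

theorem dropLast_word_append (a : Letter) (u : Word) : dropLast a (word (u ++ [a])) = word u := by
  ext v
  rw [dropLast_apply]
  exact Finsupp.single_apply_left (List.append_left_injective [a]) u v 1

theorem dropLast_word_append_ne {a b : Letter} (h : b ≠ a) (u : Word) :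
    dropLast a (word (u ++ [b])) = 0 := by
  ext v
  simp [dropLast_apply, word, h]

theorem dropLast_word (a : Letter) (w : Word) :
    dropLast a (word w) = 0 ∨
      ∃ u : Word, u.length < w.length ∧ dropLast a (word w) = word u := by
  rcases List.eq_nil_or_concat w with rfl | ⟨u, b, rfl⟩
  · exact Or.inl (dropLast_nil a)
  · rw [List.concat_eq_append]
    by_cases h : b = a
    · subst h
      exact Or.inr ⟨u, by simp, dropLast_word_append _ _⟩
    · exact Or.inl (dropLast_word_append_ne h _)

/-- `τ` turns removal of a last letter into removal of a first letter, and both are derivations. By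
induction on total length the two sides agree after removal of any first letter, and their constant
terms agree. -/
theorem tauLinear_shuffle_word (N : ℕ) : ∀ u v : Word, u.length + v.length < N →
    tauLinear (shuffle (word u) (word v)) =
      shuffle (tauLinear (word u)) (tauLinear (word v)) := by
  induction N with
  | zero => intro u v h; omega
  | succ N ih =>
    intro u v h
    refine ext_dropHead ?_ fun a => ?_
    · rw [tauLinear_apply, shuffle_apply_nil, tauLinear_apply, tauLinear_apply]
      exact shuffle_apply_nil _ _
    · rw [dropHead_tauLinear, dropLast_shuffle, dropHead_shuffle, dropHead_tauLinear,
        dropHead_tauLinear, map_add]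
      congr 1
      · rcases dropLast_word (swap a) u with h' | ⟨u', hl, h'⟩
        · simp [h']
        · rw [h', ih u' v (by omega)]
      · rcases dropLast_word (swap a) v with h' | ⟨v', hl, h'⟩
        · simp [h']
        · rw [h', ih u v' (by omega)]

theorem tauLinear_shuffle (f g : H) :
    tauLinear (shuffle f g) = shuffle (tauLinear f) (tauLinear g) := by
  have : shuffle.compr₂ tauLinear = shuffle.compl₁₂ tauLinear tauLinear :=
    word_ext₂ fun u v => tauLinear_shuffle_word _ u v (Nat.lt_succ_self _)
  exact congrArg (fun F : H →ₗ[ℂ] H →ₗ[ℂ] H => F f g) this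

/-! ### Deconcatenation -/

open TensorProduct

/-- The deconcatenation coproduct on words. -/
noncomputable def deconcatWord : Word → H ⊗[ℂ] H
  | [] => word [] ⊗ₜ word []
  | a :: w => word [] ⊗ₜ word (a :: w) + (cons a).rTensor H (deconcatWord w)

/-- The deconcatenation coproduct. -/
noncomputable def deconcat : H →ₗ[ℂ] H ⊗[ℂ] H := Finsupp.linearCombination ℂ deconcatWord

theorem deconcat_word (w : Word) : deconcat (word w) = deconcatWord w := by
  simp [deconcat, word]

theorem deconcat_nil : deconcat (word []) = word [] ⊗ₜ word [] := deconcat_word []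

theorem deconcat_cons (a : Letter) (f : H) :
    deconcat (cons a f) = word [] ⊗ₜ cons a f + (cons a).rTensor H (deconcat f) := by
  have : deconcat ∘ₗ cons a =
      (TensorProduct.mk ℂ H H (word [])) ∘ₗ cons a + (cons a).rTensor H ∘ₗ deconcat :=
    word_ext fun w => by
      simp only [LinearMap.comp_apply, LinearMap.add_apply, cons_word, deconcat_word,
        TensorProduct.mk_apply]
      rfl
  exact congrArg (fun F : H →ₗ[ℂ] H ⊗[ℂ] H => F f) this

theorem deconcatWord_eq_sum (w : Word) : deconcatWord w =
    ∑ i ∈ Finset.range (w.length + 1), word (w.take i) ⊗ₜ word (w.drop i) := by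
  induction w with
  | nil => simp [deconcatWord]
  | cons a w ih =>
    rw [deconcatWord, ih, List.length_cons, Finset.sum_range_succ' _ (w.length + 1), map_sum, add_comm]
    simp [cons_word]

/-- The shuffle product on `𝔥 ⊗ 𝔥`. -/
noncomputable def shuffleTensor : H ⊗[ℂ] H →ₗ[ℂ] H ⊗[ℂ] H →ₗ[ℂ] H ⊗[ℂ] H :=
  TensorProduct.map₂ shuffle shuffle

theorem shuffleTensor_tmul (f f' g g' : H) :
    shuffleTensor (f ⊗ₜ f') (g ⊗ₜ g') = shuffle f g ⊗ₜ shuffle f' g' := by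
  rw [shuffleTensor, TensorProduct.map₂_apply_tmul, TensorProduct.map_tmul]

theorem nil_tmul_shuffleTensor_cons (f : H) (b : Letter) (q : H ⊗[ℂ] H) :
    shuffleTensor (word [] ⊗ₜ f) ((cons b).rTensor H q) =
      (cons b).rTensor H (shuffleTensor (word [] ⊗ₜ f) q) := by
  induction q with
  | zero => simp
  | add p q hp hq => simp only [map_add, hp, hq]
  | tmul g g' => simp [shuffleTensor_tmul, nil_shuffle]

theorem cons_shuffleTensor_nil_tmul (f : H) (b : Letter) (q : H ⊗[ℂ] H) :
    shuffleTensor ((cons b).rTensor H q) (word [] ⊗ₜ f) =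
      (cons b).rTensor H (shuffleTensor q (word [] ⊗ₜ f)) := by
  induction q with
  | zero => simp
  | add p q hp hq => simp only [map_add, LinearMap.add_apply, hp, hq]
  | tmul g g' => simp [shuffleTensor_tmul, shuffle_nil]

theorem cons_shuffleTensor_cons (a b : Letter) (p q : H ⊗[ℂ] H) :
    shuffleTensor ((cons a).rTensor H p) ((cons b).rTensor H q) =
      (cons a).rTensor H (shuffleTensor p ((cons b).rTensor H q)) +
      (cons b).rTensor H (shuffleTensor ((cons a).rTensor H p) q) := by
  induction p with
  | zero => simp
  | add p p' hp hp' =>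
    simp only [map_add, LinearMap.add_apply, hp, hp']
    abel
  | tmul f f' =>
    induction q with
    | zero => simp
    | add q q' hq hq' =>
      simp only [map_add, hq, hq']
      abel
    | tmul g g' => simp [shuffleTensor_tmul, cons_shuffle_cons, TensorProduct.add_tmul]

/-- Cutting a shuffle of two words amounts to cutting each word and shuffling prefixes with prefixes
and suffixes with suffixes. In the induction the term with empty prefix is split off, and the rest
obeys the shuffle recursion in the left tensor factor. -/
theorem deconcat_shuffle (f g : H) :
    deconcat (shuffle f g) = shuffleTensor (deconcat f) (deconcat g) := by
  have key : ∀ g, shuffleTensor (word [] ⊗ₜ word []) (deconcat g) = deconcat g ∧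
      shuffleTensor (deconcat g) (word [] ⊗ₜ word []) = deconcat g := by
    intro g
    induction deconcat g with
    | zero => simp
    | add p q hp hq => simp only [map_add, LinearMap.add_apply, hp, hq, and_self]
    | tmul g g' => simp [shuffleTensor_tmul, nil_shuffle, shuffle_nil]
  have : shuffle.compr₂ deconcat = shuffleTensor.compl₁₂ deconcat deconcat := by
    suffices h : ∀ u v, deconcat (shuffle (word u) (word v)) =
        shuffleTensor (deconcat (word u)) (deconcat (word v)) from
      word_ext fun u => word_ext fun v => h u v
    refine word_cases _ ?_ ?_ ?_
    · intro v
      simp [nil_shuffle, deconcat_nil, key]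
    · intro u
      simp [shuffle_nil, deconcat_nil, key]
    · intro a u b v h₁ h₂
      simp only [← cons_word] at h₁ h₂ ⊢
      rw [cons_shuffle_cons, map_add, deconcat_cons, deconcat_cons, h₁, h₂, deconcat_cons,
        deconcat_cons]
      simp only [map_add, LinearMap.add_apply, nil_tmul_shuffleTensor_cons,
        cons_shuffleTensor_nil_tmul, cons_shuffleTensor_cons, shuffleTensor_tmul, nil_shuffle,
        cons_shuffle_cons, TensorProduct.tmul_add]
      abel
  exact congrArg (fun F : H →ₗ[ℂ] H →ₗ[ℂ] H ⊗[ℂ] H => F f g) this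

/-- The convolution of two linear functionals, dual to deconcatenation. -/
noncomputable def convolution (φ ψ : H →ₗ[ℂ] ℂ) : H →ₗ[ℂ] ℂ :=
  LinearMap.mul' ℂ ℂ ∘ₗ TensorProduct.map φ ψ ∘ₗ deconcat

theorem convolution_word (φ ψ : H →ₗ[ℂ] ℂ) (w : Word) : convolution φ ψ (word w) =
    ∑ i ∈ Finset.range (w.length + 1), φ (word (w.take i)) * ψ (word (w.drop i)) := by
  simp [convolution, deconcat_word, deconcatWord_eq_sum]

theorem convolution_shuffle {φ ψ : H →ₗ[ℂ] ℂ} (hφ : ∀ f g, φ (shuffle f g) = φ f * φ g)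
    (hψ : ∀ f g, ψ (shuffle f g) = ψ f * ψ g) (f g : H) :
    convolution φ ψ (shuffle f g) = convolution φ ψ f * convolution φ ψ g := by
  have key : ∀ p q : H ⊗[ℂ] H, LinearMap.mul' ℂ ℂ (TensorProduct.map φ ψ (shuffleTensor p q)) =
      LinearMap.mul' ℂ ℂ (TensorProduct.map φ ψ p) *
        LinearMap.mul' ℂ ℂ (TensorProduct.map φ ψ q) := by
    intro p q
    induction p with
    | zero => simp
    | add p p' hp hp' => simp only [map_add, LinearMap.add_apply, hp, hp', add_mul]
    | tmul f f' =>
      induction q with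
      | zero => simp
      | add q q' hq hq' => simp only [map_add, hq, hq', mul_add]
      | tmul g g' =>
        simp only [shuffleTensor_tmul, TensorProduct.map_tmul, LinearMap.mul'_apply, hφ, hψ]
        ring
  simp only [convolution, LinearMap.comp_apply, deconcat_shuffle, key]

/-- A shuffle character vanishing on both letters is determined by its values on `𝔥⁰`. -/
theorem eq_comp_reg {φ : H →ₗ[ℂ] ℂ} (hφ : ∀ f g, φ (shuffle f g) = φ f * φ g)
    (hx : φ (word [Letter.x]) = 0) (hy : φ (word [Letter.y]) = 0) (f : H) :
    φ f = φ (reg f : H) := by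
  -- Hence `φ` kills every component `y^m ⧢ c ⧢ x^n` with `(m, n) ≠ (0, 0)`.
  have hpow : ∀ a, φ (word [a]) = 0 → ∀ n, φ (shufflePow (word [a]) (n + 1)) = 0 := by
    intro a ha n
    rw [shufflePow, hφ, ha, mul_zero]
  obtain ⟨c, rfl⟩ := decompYX.surjective f
  rw [reg, LinearEquiv.symm_apply_apply]
  change φ (sumYX c) = _
  induction c using Finsupp.induction_linear with
  | zero => simp
  | add c d hc hd => simp only [map_add, hc, hd, Finsupp.add_apply, Submodule.coe_add]
  | single p c =>
    rcases p with ⟨_ | m, _ | n⟩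
    · simp [sumYX, shufflePow, nil_shuffle, shuffle_nil]
    · simp [sumYX, hφ, hpow _ hx]
    · simp [sumYX, hφ, hpow _ hy]
    · simp [sumYX, hφ, hpow _ hx]

/-! ### Primitives along segments from the origin -/

/-- Differentiation under the integral sign: the `w`-derivative of `f (t w) w` equals the
`t`-derivative of `t f (t w)`, so its integral over `[0, 1]` is `f w`. -/
theorem hasDerivAt_integralFromZero {U : Set ℂ} (hU : IsOpen U)
    (hstar : ∀ z ∈ U, ∀ t ∈ Set.Icc (0 : ℝ) 1, (t : ℂ) * z ∈ U) {f : ℂ → ℂ}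
    (hf : DifferentiableOn ℂ f U) {z : ℂ} (hz : z ∈ U) :
    HasDerivAt (integralFromZero f) (f z) z := by
  obtain ⟨ε, hε, hball⟩ := Metric.nhds_basis_closedBall.mem_iff.mp (hU.mem_nhds hz)
  have hf' : DifferentiableOn ℂ (deriv f) U := hf.deriv hU
  have hd : ∀ w ∈ U, HasDerivAt f (deriv f w) w := fun w hw =>
    (hf.differentiableAt (hU.mem_nhds hw)).hasDerivAt
  have hIoc : Set.uIoc (0 : ℝ) 1 ⊆ Set.Icc 0 1 := by
    rw [Set.uIoc_of_le zero_le_one]; exact Set.Ioc_subset_Icc_self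
  set F : ℂ → ℝ → ℂ := fun w t => f (t * w) * w with hF
  set F' : ℂ → ℝ → ℂ := fun w t => deriv f (t * w) * t * w + f (t * w) with hF'
  have hmap : Set.MapsTo (fun p : ℝ × ℂ => (p.1 : ℂ) * p.2)
      (Set.Icc 0 1 ×ˢ Metric.closedBall z ε) U := fun p hp => hstar _ (hball hp.2) _ hp.1
  have hmul : Continuous fun p : ℝ × ℂ => (p.1 : ℂ) * p.2 := by fun_prop
  have hcf : ContinuousOn (fun p : ℝ × ℂ => f ((p.1 : ℂ) * p.2))
      (Set.Icc 0 1 ×ˢ Metric.closedBall z ε) :=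
    ContinuousOn.comp (g := f) hf.continuousOn hmul.continuousOn hmap
  have hcf' : ContinuousOn (fun p : ℝ × ℂ => deriv f ((p.1 : ℂ) * p.2))
      (Set.Icc 0 1 ×ˢ Metric.closedBall z ε) :=
    ContinuousOn.comp (g := deriv f) hf'.continuousOn hmul.continuousOn hmap
  have hcF' : ContinuousOn (fun p : ℝ × ℂ => F' p.2 p.1)
      (Set.Icc 0 1 ×ˢ Metric.closedBall z ε) := by
    have h₁ : ContinuousOn (fun p : ℝ × ℂ => (p.1 : ℂ))
      (Set.Icc 0 1 ×ˢ Metric.closedBall z ε) := by fun_prop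
    exact ((hcf'.mul h₁).mul continuousOn_snd).add hcf
  have hcF : ContinuousOn (fun p : ℝ × ℂ => F p.2 p.1)
      (Set.Icc 0 1 ×ˢ Metric.closedBall z ε) := hcf.mul continuousOn_snd
  have hslice : ∀ w ∈ Metric.closedBall z ε, Set.MapsTo (fun t : ℝ => (t, w)) (Set.Icc 0 1)
      (Set.Icc 0 1 ×ˢ Metric.closedBall z ε) := fun w hw t ht => ⟨ht, hw⟩
  have hcFw : ∀ w ∈ Metric.closedBall z ε, ContinuousOn (F w) (Set.Icc 0 1) := fun w hw =>
    ContinuousOn.comp (f := fun t : ℝ => (t, w)) (g := fun p : ℝ × ℂ => F p.2 p.1) hcF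
      (continuous_id.prodMk continuous_const).continuousOn (hslice w hw)
  have hcF'w : ∀ w ∈ Metric.closedBall z ε, ContinuousOn (F' w) (Set.Icc 0 1) := fun w hw =>
    ContinuousOn.comp (f := fun t : ℝ => (t, w)) (g := fun p : ℝ × ℂ => F' p.2 p.1) hcF'
      (continuous_id.prodMk continuous_const).continuousOn (hslice w hw)
  have hzz : z ∈ Metric.closedBall z ε := Metric.mem_closedBall_self hε.le
  obtain ⟨M, hM⟩ := (isCompact_Icc.prod (isCompact_closedBall z ε)).exists_bound_of_continuousOn
    hcF'
  have hdF : ∀ t ∈ Set.Icc (0 : ℝ) 1, ∀ w ∈ Metric.closedBall z ε,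
      HasDerivAt (fun w => F w t) (F' w t) w := fun t ht w hw => by
    have h₁ : HasDerivAt (fun w : ℂ => (t : ℂ) * w) t w := by
      simpa using (hasDerivAt_id w).const_mul (t : ℂ)
    have h₂ : HasDerivAt (fun w : ℂ => f (t * w)) (deriv f (t * w) * t) w :=
      HasDerivAt.comp (h₂ := f) (h := fun w : ℂ => (t : ℂ) * w) w
        (hd _ (hstar _ (hball hw) _ ht)) h₁
    have h₃ := h₂.mul (hasDerivAt_id w)
    rw [mul_one] at h₃
    exact h₃
  have hdG : ∀ t ∈ Set.Icc (0 : ℝ) 1,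
      HasDerivAt (fun t : ℝ => (t : ℂ) * f (t * z)) (F' z t) t := fun t ht => by
    have h₁ : HasDerivAt (fun t : ℝ => (t : ℂ)) 1 t := Complex.ofRealCLM.hasDerivAt
    have h₂ : HasDerivAt (fun t : ℝ => f (t * z)) (deriv f (t * z) * (1 * z)) t :=
      HasDerivAt.comp (h₂ := f) (h := fun t : ℝ => (t : ℂ) * z) t
        (hd _ (hstar z hz t ht)) (h₁.mul_const z)
    have h₃ := h₁.mul h₂
    refine h₃.congr_deriv ?_
    simp only [hF']
    ring
  have key := intervalIntegral.hasDerivAt_integral_of_dominated_loc_of_deriv_le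
    (μ := MeasureTheory.volume) (a := 0) (b := 1) (F := F) (F' := F') (x₀ := z)
    (s := Metric.closedBall z ε) (bound := fun _ => M) (Metric.closedBall_mem_nhds z hε)
    (by
      filter_upwards [Metric.closedBall_mem_nhds z hε] with w hw
      exact ((hcFw w hw).mono hIoc).aestronglyMeasurable measurableSet_uIoc)
    (ContinuousOn.intervalIntegrable (by rw [Set.uIcc_of_le zero_le_one]; exact hcFw z hzz))
    (((hcF'w z hzz).mono hIoc).aestronglyMeasurable measurableSet_uIoc)
    (Filter.Eventually.of_forall fun t ht w hw => hM (t, w) ⟨hIoc ht, hw⟩)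
    intervalIntegrable_const
    (Filter.Eventually.of_forall fun t ht w hw => hdF t (hIoc ht) w hw)
  have hint : ∫ t in (0 : ℝ)..1, F' z t = f z := by
    have := intervalIntegral.integral_eq_sub_of_hasDerivAt (a := 0) (b := 1)
      (f := fun t : ℝ => (t : ℂ) * f (t * z)) (f' := F' z) (fun t ht => by
        rw [Set.uIcc_of_le zero_le_one] at ht
        exact hdG t ht)
      (ContinuousOn.intervalIntegrable (by rw [Set.uIcc_of_le zero_le_one]; exact hcF'w z hzz))
    rw [this]; simp
  rw [← hint]
  exact key.2

theorem integralFromZero_zero (f : ℂ → ℂ) : integralFromZero f 0 = 0 := by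
  simp [integralFromZero]

/-- Excluding `t = 0` matters: there `LiWord w s / s` has the default value of a division by zero.
-/
theorem integralFromZero_congr {f g : ℂ → ℂ} {z : ℂ}
    (h : ∀ t ∈ Set.Ioo (0 : ℝ) 1, z ≠ 0 → f (t * z) = g (t * z)) :
    integralFromZero f z = integralFromZero g z := by
  refine intervalIntegral.integral_congr_uIoo fun t ht => ?_
  rw [Set.uIoo_of_le zero_le_one] at ht
  by_cases hz : z = 0
  · simp [hz]
  · simp only [h t ht hz]

/-! ### Multiple polylogarithms are holomorphic -/

/-- The plane cut along `[1, ∞)`. -/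
def slitOne : Set ℂ := {z | 1 - z ∈ Complex.slitPlane}

theorem mem_slitOne {z : ℂ} : z ∈ slitOne ↔ z.re < 1 ∨ z.im ≠ 0 := by
  simp [slitOne, Complex.mem_slitPlane_iff]

theorem isOpen_slitOne : IsOpen slitOne :=
  Complex.isOpen_slitPlane.preimage (continuous_const.sub continuous_id)

theorem zero_mem_slitOne : (0 : ℂ) ∈ slitOne := by simp [mem_slitOne]

theorem mul_mem_slitOne (z : ℂ) (hz : z ∈ slitOne) (t : ℝ) (ht : t ∈ Set.Icc (0 : ℝ) 1) :
    (t : ℂ) * z ∈ slitOne := by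
  rw [mem_slitOne] at hz ⊢
  rw [Complex.re_ofReal_mul, Complex.im_ofReal_mul]
  rcases ht.1.eq_or_lt with rfl | h0
  · simp
  · refine hz.imp (fun h => ?_) fun h => mul_ne_zero h0.ne' h
    rcases le_or_gt z.re 0 with h' | h'
    · nlinarith
    · nlinarith [ht.2]

theorem one_sub_ne_zero_of_mem_slitOne {z : ℂ} (hz : z ∈ slitOne) : 1 - z ≠ 0 :=
  Complex.slitPlane_ne_zero hz

/-- The words spanning `𝔥¹`. -/
def EndsInY (w : Word) : Prop := w = [] ∨ ∃ u : Word, w = u ++ [Letter.y]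

theorem EndsInY.of_cons {a : Letter} {w : Word} (h : EndsInY (a :: w)) : EndsInY w := by
  rcases h with h | ⟨u, h⟩
  · simp at h
  · rcases u with _ | ⟨b, u⟩
    · simp only [List.nil_append, List.cons.injEq] at h
      exact Or.inl h.2
    · rw [List.cons_append, List.cons.injEq] at h
      exact Or.inr ⟨u, h.2⟩

theorem EndsInY.ne_nil_of_cons_x {w : Word} (h : EndsInY (Letter.x :: w)) : w ≠ [] := by
  rintro rfl
  rcases h with h | ⟨u, h⟩
  · simp at h
  · have := congrArg List.getLast? h
    simp at this

theorem EndsInY.drop {w : Word} (h : EndsInY w) (i : ℕ) : EndsInY (w.drop i) := by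
  induction i generalizing w with
  | zero => exact h
  | succ i ih =>
    cases w with
    | nil => exact Or.inl rfl
    | cons a w => exact ih h.of_cons

theorem word_mem_h1 {w : Word} (h : EndsInY w) : word w ∈ h1 :=
  Finsupp.single_mem_supported ℂ 1 h

/-- The differential form attached to a letter, as a function. -/
noncomputable def kernel : Letter → ℂ → ℂ
  | Letter.x, z => 1 / z
  | Letter.y, z => 1 / (1 - z)

theorem LiWord_cons_zero (a : Letter) (w : Word) : LiWord (a :: w) 0 = 0 := by
  cases a <;> exact integralFromZero_zero _

theorem LiWord_zero {w : Word} (h : w ≠ []) : LiWord w 0 = 0 := by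
  cases w with
  | nil => exact absurd rfl h
  | cons a w => exact LiWord_cons_zero a w

/-- Holomorphy and the derivative go through one induction, as the integrand must be holomorphic
across `0`. The derivative is stated off `0` because `kernel Letter.x` is singular there. -/
theorem LiWord_aux {w : Word} (hw : EndsInY w) : DifferentiableOn ℂ (LiWord w) slitOne ∧
    ∀ a u, w = a :: u → ∀ z ∈ slitOne, z ≠ 0 →
      HasDerivAt (LiWord w) (kernel a z * LiWord u z) z := by
  induction w with
  | nil =>
    refine ⟨?_, by simp⟩
    have : LiWord [] = fun _ => (1 : ℂ) := by ext z; rfl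
    rw [this]; exact differentiableOn_const _
  | cons a w ih =>
    have hd := (ih hw.of_cons).1
    obtain ⟨g, hg, hgi, hgz⟩ : ∃ g : ℂ → ℂ, DifferentiableOn ℂ g slitOne ∧
        LiWord (a :: w) = integralFromZero g ∧ ∀ z, z ≠ 0 → g z = kernel a z * LiWord w z := by
      cases a with
      | x =>
        -- A word followed by `x` on its left is nonempty, so its polylogarithm vanishes at `0` and
        -- the pole of `1 / s` is removable; `dslope` is the holomorphic extension of the quotient.
        have hgz : ∀ z, z ≠ 0 → dslope (LiWord w) 0 z = LiWord w z / z := fun z hz => by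
          rw [dslope_of_ne _ hz, slope_def_field, LiWord_zero hw.ne_nil_of_cons_x, sub_zero,
            sub_zero]
        refine ⟨dslope (LiWord w) 0, (Complex.differentiableOn_dslope
          (isOpen_slitOne.mem_nhds zero_mem_slitOne)).mpr hd, ?_, fun z hz => ?_⟩
        · ext z
          refine integralFromZero_congr fun t ht hz => ?_
          rw [hgz _ (mul_ne_zero (by exact_mod_cast ht.1.ne') hz)]
        · rw [hgz z hz, kernel]; ring
      | y =>
        refine ⟨fun s => LiWord w s / (1 - s), hd.div (by fun_prop)
          fun z hz => one_sub_ne_zero_of_mem_slitOne hz, rfl, fun z _ => ?_⟩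
        simp only [kernel]; ring
    have hD : ∀ z ∈ slitOne, HasDerivAt (LiWord (a :: w)) (g z) z := fun z hz => by
      rw [hgi]
      exact hasDerivAt_integralFromZero isOpen_slitOne mul_mem_slitOne hg hz
    refine ⟨fun z hz => (hD z hz).differentiableAt.differentiableWithinAt, ?_⟩
    intro b u h z hz hz0
    rw [List.cons.injEq] at h
    obtain ⟨rfl, rfl⟩ := h
    rw [← hgz z hz0]
    exact hD z hz

theorem differentiableOn_LiWord {w : Word} (hw : EndsInY w) :
    DifferentiableOn ℂ (LiWord w) slitOne := (LiWord_aux hw).1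

theorem hasDerivAt_LiWord_cons {a : Letter} {w : Word} (hw : EndsInY (a :: w)) {z : ℂ}
    (hz : z ∈ slitOne) (hz0 : z ≠ 0) :
    HasDerivAt (LiWord (a :: w)) (kernel a z * LiWord w z) z :=
  (LiWord_aux hw).2 a w rfl z hz hz0

/-! ### Power series of multiple polylogarithms -/

theorem hasSum_of_eq {E : Type*} [AddCommMonoid E] [TopologicalSpace E] {f g : ℕ → E} {a : E}
    (hfg : ∀ n, f n = g n) (h : HasSum f a) : HasSum g a := funext hfg ▸ h

/-- The coefficient of `z ^ n` in the multiple polylogarithm of a word. -/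
noncomputable def LiCoeff : Word → ℕ → ℝ
  | [], n => if n = 0 then 1 else 0
  | Letter.x :: w, n => LiCoeff w n / n
  | Letter.y :: w, n => (∑ m ∈ Finset.range n, LiCoeff w m) / n

theorem LiCoeff_nonneg (w : Word) (n : ℕ) : 0 ≤ LiCoeff w n := by
  induction w generalizing n with
  | nil => rw [LiCoeff]; split_ifs <;> norm_num
  | cons a w ih =>
    cases a with
    | x => exact div_nonneg (ih n) n.cast_nonneg
    | y => exact div_nonneg (Finset.sum_nonneg fun m _ => ih m) n.cast_nonneg

theorem LiCoeff_zero {w : Word} (hw : w ≠ []) : LiCoeff w 0 = 0 := by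
  rcases w with _ | ⟨_ | _, w⟩
  · exact absurd rfl hw
  · simp [LiCoeff]
  · simp [LiCoeff]

theorem LiCoeff_le_one (w : Word) (n : ℕ) : LiCoeff w n ≤ 1 := by
  induction w generalizing n with
  | nil => rw [LiCoeff]; split_ifs <;> norm_num
  | cons a w ih =>
    rcases n.eq_zero_or_pos with rfl | hn
    · rw [LiCoeff_zero (by simp)]; exact zero_le_one
    · have hn' : (1 : ℝ) ≤ n := by exact_mod_cast hn
      cases a with
      | x => exact (div_le_one (by linarith)).mpr ((ih n).trans hn')
      | y =>
        refine (div_le_one (by linarith)).mpr ?_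
        simpa using Finset.sum_le_sum fun m (_ : m ∈ Finset.range n) => ih m

/-! ### Decay of the Taylor coefficients. -/

theorem sum_one_div_sqrt_le (n : ℕ) :
    ∑ m ∈ Finset.range (n + 1), 1 / √(m : ℝ) ≤ 2 * √(n : ℝ) := by
  induction n with
  | zero => simp
  | succ n ih =>
    rw [Finset.sum_range_succ]
    have h₁ : (√((n + 1 : ℕ) : ℝ)) ^ 2 = n + 1 := by
      rw [Real.sq_sqrt (by positivity)]; push_cast; rfl
    have h₂ : (√(n : ℝ)) ^ 2 = n := Real.sq_sqrt (by positivity)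
    have h₃ : 0 < √((n + 1 : ℕ) : ℝ) := Real.sqrt_pos.mpr (by positivity)
    have h₄ : 1 / √((n + 1 : ℕ) : ℝ) ≤ 2 * √((n + 1 : ℕ) : ℝ) - 2 * √(n : ℝ) := by
      rw [div_le_iff₀ h₃]
      -- With `a² - b² = 1` the inequality `1 ≤ (2a - 2b) a` is `0 ≤ (a - b)²`.
      nlinarith [sq_nonneg (√((n + 1 : ℕ) : ℝ) - √(n : ℝ))]
    linarith

/-- The bound `n^(-1/2)` is cruder than the true order but survives both letters: dividing by `n`
only helps, and averaging preserves it since `∑ m^(-1/2) ≤ 2 √n`. It gives decay for all words, and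
summability after one more `x`. -/
theorem exists_LiCoeff_le (w : Word) :
    ∃ C : ℝ, 0 ≤ C ∧ ∀ n, 0 < n → LiCoeff w n ≤ C / √(n : ℝ) := by
  induction w with
  | nil => exact ⟨0, le_rfl, fun n hn => by simp [LiCoeff, hn.ne']⟩
  | cons a w ih =>
    obtain ⟨C, hC, h⟩ := ih
    cases a with
    | x =>
      refine ⟨C, hC, fun n hn => le_trans ?_ (h n hn)⟩
      exact div_le_self (LiCoeff_nonneg w n) (by exact_mod_cast hn)
    | y =>
      -- The `1` pays for the term `m = 0`, not covered by the induction hypothesis; the `2` comes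
      -- from `sum_one_div_sqrt_le`.
      refine ⟨1 + C * 2, by positivity, fun n hn => ?_⟩
      obtain ⟨n, rfl⟩ := Nat.exists_eq_succ_of_ne_zero hn.ne'
      have hs : 1 ≤ √((n.succ : ℕ) : ℝ) := Real.one_le_sqrt.mpr (by exact_mod_cast hn)
      have hle : √(n : ℝ) ≤ √((n.succ : ℕ) : ℝ) := Real.sqrt_le_sqrt (by simp)
      have hsum : ∑ m ∈ Finset.range n.succ, LiCoeff w m ≤ 1 + C * (2 * √(n : ℝ)) := by
        calc ∑ m ∈ Finset.range (n + 1), LiCoeff w m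
            ≤ ∑ m ∈ Finset.range (n + 1), ((if m = 0 then 1 else 0) + C * (1 / √(m : ℝ))) := by
              refine Finset.sum_le_sum fun m _ => ?_
              rcases m.eq_zero_or_pos with rfl | hm
              · simpa using LiCoeff_le_one w 0
              · simpa [hm.ne', div_eq_mul_inv] using h m hm
          _ = 1 + C * ∑ m ∈ Finset.range (n + 1), 1 / √(m : ℝ) := by
              rw [Finset.sum_add_distrib, ← Finset.mul_sum]; simp
          _ ≤ _ := by gcongr; exact sum_one_div_sqrt_le n
      have hsq : (√((n.succ : ℕ) : ℝ)) * √((n.succ : ℕ) : ℝ) = (n.succ : ℕ) :=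
        Real.mul_self_sqrt (by positivity)
      rw [LiCoeff, div_le_div_iff₀ (by positivity) (by positivity)]
      calc (∑ m ∈ Finset.range n.succ, LiCoeff w m) * √((n.succ : ℕ) : ℝ)
          ≤ ((1 + C * 2) * √((n.succ : ℕ) : ℝ)) * √((n.succ : ℕ) : ℝ) := by
            refine mul_le_mul_of_nonneg_right ?_ (by positivity)
            nlinarith
        _ = (1 + C * 2) * (n.succ : ℕ) := by rw [mul_assoc, hsq]

theorem tendsto_LiCoeff (w : Word) :
    Filter.Tendsto (LiCoeff w) Filter.atTop (nhds 0) := by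
  obtain ⟨C, -, h⟩ := exists_LiCoeff_le w
  refine squeeze_zero' (Filter.Eventually.of_forall (LiCoeff_nonneg w))
    ((Filter.eventually_gt_atTop 0).mono h) ?_
  exact tendsto_const_nhds.div_atTop
    (Real.tendsto_sqrt_atTop.comp tendsto_natCast_atTop_atTop)

theorem summable_LiCoeff_cons_x (w : Word) : Summable (LiCoeff (Letter.x :: w)) := by
  obtain ⟨C, -, h⟩ := exists_LiCoeff_le w
  have hs : Summable fun n : ℕ => C * (1 / (n : ℝ) ^ (3 / 2 : ℝ)) :=
    (Real.summable_one_div_nat_rpow.mpr (by norm_num)).mul_left C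
  refine Summable.of_nonneg_of_le (LiCoeff_nonneg _) (fun n => ?_) hs
  rcases n.eq_zero_or_pos with rfl | hn
  · rw [LiCoeff_zero (by simp)]; simp
  · have hn' : (0 : ℝ) < n := by exact_mod_cast hn
    have : (n : ℝ) ^ (3 / 2 : ℝ) = √(n : ℝ) * n := by
      rw [Real.sqrt_eq_rpow, ← Real.rpow_add_one hn'.ne']; norm_num
    rw [LiCoeff, this, mul_one_div, ← div_div]
    exact div_le_div_of_nonneg_right (h n hn) hn'.le

/-- Termwise integration by dominated convergence. The bound `n + 1` covers both letters: shifted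
coefficients for `x`, partial sums of coefficients for `y`. -/
theorem hasSum_integralFromZero {c : ℕ → ℂ} (hc : ∀ n, ‖c n‖ ≤ n + 1) {f : ℂ → ℂ} {z : ℂ}
    (hz : ‖z‖ < 1)
    (hf : ∀ t ∈ Set.Ioo (0 : ℝ) 1, z ≠ 0 → HasSum (fun n => c n * (t * z) ^ n) (f (t * z))) :
    HasSum (fun n => c n / (n + 1) * z ^ (n + 1)) (integralFromZero f z) := by
  rcases eq_or_ne z 0 with rfl | hz0
  · rw [integralFromZero_zero]
    convert hasSum_zero with n
    simp
  have hint : ∀ n : ℕ, ∫ t in (0 : ℝ)..1, c n * (t * z) ^ n * z =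
      c n / (n + 1) * z ^ (n + 1) := by
    intro n
    have h₁ : ∀ t : ℝ, c n * (t * z) ^ n * z = (c n * z ^ (n + 1)) * ((t ^ n : ℝ) : ℂ) := by
      intro t; push_cast; ring
    simp_rw [h₁]
    rw [intervalIntegral.integral_const_mul, intervalIntegral.integral_ofReal, integral_pow]
    push_cast
    simp
    ring
  simp_rw [← hint]
  have hs : Summable fun n : ℕ => ((n : ℝ) + 1) * ‖z‖ ^ n * ‖z‖ := by
    refine Summable.mul_right _ ?_
    simp_rw [add_mul, one_mul]
    refine Summable.add ?_ (summable_geometric_of_lt_one (norm_nonneg z) hz)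
    simpa using summable_pow_mul_geometric_of_norm_lt_one 1 (r := ‖z‖) (by simpa using hz)
  refine intervalIntegral.hasSum_integral_of_dominated_convergence
    (fun n _ => ((n : ℝ) + 1) * ‖z‖ ^ n * ‖z‖) (fun n => ?_) (fun n => ?_)
    (Filter.Eventually.of_forall fun t _ => hs) intervalIntegrable_const ?_
  · exact (Continuous.aestronglyMeasurable (by fun_prop))
  · refine Filter.Eventually.of_forall fun t ht => ?_
    rw [Set.uIoc_of_le zero_le_one] at ht
    rw [norm_mul, norm_mul, norm_pow, norm_mul, Complex.norm_real, Real.norm_of_nonneg ht.1.le]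
    have h₁ := ht.1.le
    have h₂ : t * ‖z‖ ≤ ‖z‖ := mul_le_of_le_one_left (norm_nonneg z) ht.2
    have h₃ := hc n
    gcongr
  · have h1 : ∀ᵐ t : ℝ, t ≠ 1 := by simp [MeasureTheory.ae_iff]
    filter_upwards [h1] with t ht1 ht
    rw [Set.uIoc_of_le zero_le_one] at ht
    exact (hf t ⟨ht.1, lt_of_le_of_ne ht.2 ht1⟩ hz0).mul_right z

theorem hasSum_div_one_sub {b : ℕ → ℂ} {s a : ℂ} (hs : ‖s‖ < 1)
    (hb : ∀ n, ‖b n‖ ≤ 1) (h : HasSum (fun n => b n * s ^ n) a) :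
    HasSum (fun n => (∑ m ∈ Finset.range (n + 1), b m) * s ^ n) (a / (1 - s)) := by
  have hn : Summable fun n => ‖b n * s ^ n‖ := by
    refine Summable.of_nonneg_of_le (fun _ => norm_nonneg _) (fun n => ?_)
      (summable_geometric_of_lt_one (norm_nonneg s) hs)
    rw [norm_mul, norm_pow]
    exact mul_le_of_le_one_left (by positivity) (hb n)
  have hg : Summable fun n => ‖s ^ n‖ := by
    simp_rw [norm_pow]; exact summable_geometric_of_lt_one (norm_nonneg s) hs
  have := hasSum_sum_range_mul_of_summable_norm hn hg
  rw [h.tsum_eq, tsum_geometric_of_norm_lt_one hs, ← div_eq_mul_inv] at this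
  refine hasSum_of_eq (fun n => ?_) this
  rw [Finset.sum_mul]
  refine Finset.sum_congr rfl fun m hm => ?_
  rw [mul_assoc, ← pow_add, Nat.add_sub_cancel' (Nat.lt_succ_iff.mp (Finset.mem_range.mp hm))]

theorem norm_LiCoeff_le_one (w : Word) (n : ℕ) : ‖(LiCoeff w n : ℂ)‖ ≤ 1 := by
  rw [Complex.norm_real, Real.norm_of_nonneg (LiCoeff_nonneg w n)]
  exact LiCoeff_le_one w n

theorem hasSum_LiWord {w : Word} (hw : EndsInY w) {z : ℂ} (hz : ‖z‖ < 1) :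
    HasSum (fun n => (LiCoeff w n : ℂ) * z ^ n) (LiWord w z) := by
  induction w generalizing z with
  | nil =>
    refine hasSum_of_eq (fun n => ?_) (hasSum_ite_eq 0 (1 : ℂ))
    by_cases h : n = 0 <;> simp [LiCoeff, h]
  | cons a w ih =>
    have hlt : ∀ t ∈ Set.Ioo (0 : ℝ) 1, ‖(t : ℂ) * z‖ < 1 := fun t ht => by
      rw [norm_mul, Complex.norm_real, Real.norm_of_nonneg ht.1.le]
      nlinarith [norm_nonneg z, ht.1, ht.2]
    -- The constant coefficient vanishes, so the series is reindexed to match the powers `z ^ (n +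
    -- 1)` created by integration.
    rw [← hasSum_nat_add_iff' 1]
    simp only [Finset.sum_range_one, LiCoeff_zero (List.cons_ne_nil a w), Complex.ofReal_zero,
      zero_mul, sub_zero]
    cases a with
    | x =>
      have := hasSum_integralFromZero (c := fun n => (LiCoeff w (n + 1) : ℂ))
        (f := fun s => LiWord w s / s) (z := z)
        (fun n => (norm_LiCoeff_le_one w _).trans (by simp)) hz (fun t ht hz0 => by
          have h0 : (t : ℂ) * z ≠ 0 := mul_ne_zero (by exact_mod_cast ht.1.ne') hz0
          have h₁ := ih hw.of_cons (hlt t ht)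
          rw [← hasSum_nat_add_iff' 1] at h₁
          simp only [Finset.sum_range_one, LiCoeff_zero hw.ne_nil_of_cons_x, Complex.ofReal_zero,
            zero_mul, sub_zero] at h₁
          refine hasSum_of_eq (fun n => ?_) (h₁.div_const ((t : ℂ) * z))
          rw [pow_succ, ← mul_assoc, mul_div_cancel_right₀ _ h0])
      refine hasSum_of_eq (fun n => ?_) this
      simp [LiCoeff]
    | y =>
      have := hasSum_integralFromZero
        (c := fun n => ∑ m ∈ Finset.range (n + 1), (LiCoeff w m : ℂ))
        (f := fun s => LiWord w s / (1 - s)) (z := z)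
        (fun n => (norm_sum_le _ _).trans ((Finset.sum_le_sum fun m _ =>
          norm_LiCoeff_le_one w m).trans (by simp))) hz (fun t ht _ =>
          hasSum_div_one_sub (hlt t ht) (norm_LiCoeff_le_one w) (ih hw.of_cons (hlt t ht)))
      refine hasSum_of_eq (fun n => ?_) this
      simp [LiCoeff]

/-! ### Behaviour at `1`, by Abel's theorem. -/

theorem LiWord_ofReal {w : Word} (hw : EndsInY w) {t : ℝ} (ht : t ∈ Set.Ioo (0 : ℝ) 1) :
    LiWord w t = ((∑' n, LiCoeff w n * t ^ n : ℝ) : ℂ) := by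
  have hn : ‖(t : ℂ)‖ < 1 := by
    rw [Complex.norm_real, Real.norm_of_nonneg ht.1.le]; exact ht.2
  rw [← (hasSum_LiWord hw hn).tsum_eq, Complex.ofReal_tsum]
  push_cast
  rfl

theorem eventually_mem_Ioo : ∀ᶠ t : ℝ in nhdsWithin 1 (Set.Iio 1), t ∈ Set.Ioo (0 : ℝ) 1 :=
  Ioo_mem_nhdsLT zero_lt_one

theorem tendsto_LiWord_cons_x {w : Word} (hw : EndsInY (Letter.x :: w)) :
    Filter.Tendsto (fun t : ℝ => LiWord (Letter.x :: w) t) (nhdsWithin 1 (Set.Iio 1))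
      (nhds ((∑' n, LiCoeff (Letter.x :: w) n : ℝ) : ℂ)) := by
  refine Filter.Tendsto.congr' (eventually_mem_Ioo.mono fun t ht => (LiWord_ofReal hw ht).symm) ?_
  exact (Complex.continuous_ofReal.tendsto _).comp (Real.tendsto_tsum_powerSeries_nhdsWithin_lt
    (summable_LiCoeff_cons_x w).hasSum.tendsto_sum_nat)

/-- Multiplying by `1 - t` replaces the coefficients by their differences `d n`, whose partial sums
are the `b n`. Since these tend to `0`, the differenced series sums to `0`, and Abel's theorem
applies. -/
theorem tendsto_one_sub_mul_tsum {b : ℕ → ℝ} (hb : ∀ n, |b n| ≤ 1)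
    (h : Filter.Tendsto b Filter.atTop (nhds 0)) :
    Filter.Tendsto (fun t : ℝ => (1 - t) * ∑' n, b n * t ^ n) (nhdsWithin 1 (Set.Iio 1))
      (nhds 0) := by
  set d : ℕ → ℝ := fun n => Nat.casesOn n (b 0) fun n => b (n + 1) - b n with hd
  have hsum : ∀ n, ∑ i ∈ Finset.range (n + 1), d i = b n := by
    intro n
    induction n with
    | zero => simp [hd]
    | succ n ih => rw [Finset.sum_range_succ, ih]; simp [hd]
  have habel := Real.tendsto_tsum_powerSeries_nhdsWithin_lt (f := d) (l := 0)
    ((Filter.tendsto_add_atTop_iff_nat 1).mp (by simpa only [hsum] using h))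
  refine habel.congr' (eventually_mem_Ioo.mono fun t ht => ?_)
  have hs : Summable fun n => b n * t ^ n := by
    refine Summable.of_norm_bounded (summable_geometric_of_lt_one ht.1.le ht.2) fun n => ?_
    rw [norm_mul, Real.norm_eq_abs, norm_pow, Real.norm_of_nonneg ht.1.le]
    exact mul_le_of_le_one_left (pow_nonneg ht.1.le n) (hb n)
  have h₁ : HasSum (fun n => d (n + 1) * t ^ (n + 1))
      (((∑' n, b n * t ^ n) - b 0) - t * ∑' n, b n * t ^ n) := by
    have h₂ := (hasSum_nat_add_iff' 1).mpr hs.hasSum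
    simp only [Finset.sum_range_one, pow_zero, mul_one] at h₂
    refine hasSum_of_eq (fun n => ?_) (h₂.sub (hs.hasSum.mul_left t))
    simp only [hd]; ring
  have h₃ : HasSum (fun n => d n * t ^ n) ((1 - t) * ∑' n, b n * t ^ n) := by
    rw [← hasSum_nat_add_iff' 1]
    suffices h₅ : (1 - t) * ∑' n, b n * t ^ n - ∑ i ∈ Finset.range 1, d i * t ^ i =
        (∑' n, b n * t ^ n) - b 0 - t * ∑' n, b n * t ^ n by rw [h₅]; exact h₁
    have h₄ : d 0 = b 0 := rfl
    rw [Finset.sum_range_one, pow_zero, h₄]; ring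
  exact h₃.tsum_eq

theorem tendsto_one_sub_mul_LiWord {w : Word} (hw : EndsInY w) :
    Filter.Tendsto (fun t : ℝ => (1 - (t : ℂ)) * LiWord w t) (nhdsWithin 1 (Set.Iio 1))
      (nhds 0) := by
  have h := (Complex.continuous_ofReal.tendsto _).comp (tendsto_one_sub_mul_tsum
    (b := LiCoeff w) (fun n => by
      rw [abs_of_nonneg (LiCoeff_nonneg w n)]; exact LiCoeff_le_one w n) (tendsto_LiCoeff w))
  rw [Complex.ofReal_zero] at h
  refine h.congr' (eventually_mem_Ioo.mono fun t ht => ?_)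
  simp only [Function.comp_apply, LiWord_ofReal hw ht]
  push_cast
  rfl

/-! ### Multiple zeta values as iterated sums -/

/-- The part of the multiple zeta series with outermost summation index `n`. -/
noncomputable def mzvCoeff : List ℕ → ℕ → ℝ
  | [], n => if n = 0 then 1 else 0
  | k :: ks, n => (∑ m ∈ Finset.range n, mzvCoeff ks m) / (n : ℝ) ^ k

theorem mzvCoeff_nonneg (k : List ℕ) (n : ℕ) : 0 ≤ mzvCoeff k n := by
  induction k generalizing n with
  | nil => rw [mzvCoeff]; split_ifs <;> norm_num
  | cons k ks ih => exact div_nonneg (Finset.sum_nonneg fun m _ => ih m) (by positivity)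

/-- The accumulator counts `j` letters `x` already read, each contributing a division by `n`. The
empty word needs `j = 0`, because `exponentsAux` then discards its accumulator. -/
theorem mzvCoeff_exponentsAux {w : Word} (hw : EndsInY w) (j : ℕ) (hj : w ≠ [] ∨ j = 0) (n : ℕ) :
    mzvCoeff (exponentsAux (j + 1) w) n = LiCoeff w n / (n : ℝ) ^ j := by
  induction w generalizing j n with
  | nil =>
    obtain rfl : j = 0 := by simpa using hj
    simp [exponentsAux, mzvCoeff, LiCoeff]
  | cons a w ih =>
    cases a with
    | x =>
      rw [exponentsAux, ih hw.of_cons (j + 1) (Or.inl hw.ne_nil_of_cons_x), LiCoeff, pow_succ',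
        div_div]
    | y =>
      have h₀ : ∀ m, mzvCoeff (exponentsAux 1 w) m = LiCoeff w m := fun m => by
        simpa using ih hw.of_cons 0 (Or.inr rfl) m
      simp only [exponentsAux, mzvCoeff, LiCoeff, h₀, pow_succ', div_div]

theorem mzvCoeff_exponents {w : Word} (hw : EndsInY w) (n : ℕ) :
    mzvCoeff (exponents w) n = LiCoeff w n := by
  rw [exponents]
  simpa using mzvCoeff_exponentsAux hw 0 (Or.inr rfl) n

theorem strictAnti_cons {m : ℕ} (N : ℕ) (n : Fin m → ℕ) :
    StrictAnti (Fin.cons N n : Fin (m + 1) → ℕ) ↔ (∀ i, n i < N) ∧ StrictAnti n := by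
  constructor
  · intro h
    exact ⟨fun i => by simpa using h (Fin.succ_pos i),
      fun i j hij => by simpa using h (Fin.succ_lt_succ_iff.mpr hij)⟩
  · rintro ⟨h₁, h₂⟩ i j hij
    cases i using Fin.cases with
    | zero =>
      cases j using Fin.cases with
      | zero => exact absurd hij (lt_irrefl _)
      | succ j => simpa using h₁ j
    | succ i =>
      cases j using Fin.cases with
      | zero => exact absurd hij (Fin.not_lt_zero _)
      | succ j => simpa using h₂ (Fin.succ_lt_succ_iff.mp hij)

theorem sup_cons {m : ℕ} (N : ℕ) (n : Fin m → ℕ) (h : ∀ i, n i < N) :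
    Finset.univ.sup (Fin.cons N n : Fin (m + 1) → ℕ) = N := by
  refine le_antisymm (Finset.sup_le fun i _ => ?_)
    (Finset.le_sup (f := (Fin.cons N n : Fin (m + 1) → ℕ)) (Finset.mem_univ 0))
  cases i using Fin.cases with
  | zero => simp
  | succ i => simpa using (h i).le

open scoped ENNReal Classical in
/-- Weighting the multiple zeta series by a function of the outermost summation index. -/
theorem tsum_mzv_weighted (k : List ℕ) (φ : ℕ → ℝ≥0∞) :
    ∑' n : Fin k.length → ℕ, (if StrictAnti n ∧ ∀ i, 0 < n i then
      φ (Finset.univ.sup n) * ENNReal.ofReal (1 / ∏ i, (n i : ℝ) ^ k.get i) else 0) =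
    ∑' m, φ m * ENNReal.ofReal (mzvCoeff k m) := by
  induction k generalizing φ with
  | nil =>
    -- The supremum serves as outermost index because it also makes sense for the empty tuple, where
    -- it is `0`, the sole support of `mzvCoeff []`.
    rw [tsum_eq_single (0 : ℕ) (fun m hm => by simp [mzvCoeff, hm])]
    refine (tsum_eq_single (fun i => i.elim0 : Fin 0 → ℕ)
      (fun n hn => absurd (Subsingleton.elim _ _) hn)).trans ?_
    rw [if_pos ⟨fun i => i.elim0, fun i => i.elim0⟩]
    simp [mzvCoeff]
  | cons k ks ih =>
    refine ((Fin.consEquiv fun _ : Fin (ks.length + 1) => ℕ).tsum_eq _).symm.trans ?_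
    rw [ENNReal.tsum_prod']
    refine tsum_congr fun N => ?_
    rcases N.eq_zero_or_pos with rfl | hN
    · rw [mzvCoeff, Finset.range_zero, Finset.sum_empty, zero_div, ENNReal.ofReal_zero, mul_zero,
        ENNReal.tsum_eq_zero]
      intro n
      rw [if_neg]
      rintro ⟨-, h⟩
      simpa using h 0
    · have h₁ : ∀ n : Fin ks.length → ℕ, (if StrictAnti (Fin.cons N n : Fin (ks.length + 1) → ℕ) ∧
          ∀ i, 0 < (Fin.cons N n : Fin (ks.length + 1) → ℕ) i then
          φ (Finset.univ.sup (Fin.cons N n : Fin (ks.length + 1) → ℕ)) *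
            ENNReal.ofReal (1 / ∏ i, (((Fin.cons N n : Fin (ks.length + 1) → ℕ) i : ℕ) : ℝ) ^
              (k :: ks).get i) else 0) =
          φ N * ENNReal.ofReal (1 / (N : ℝ) ^ k) *
          (if StrictAnti n ∧ ∀ i, 0 < n i then (if Finset.univ.sup n < N then 1 else 0) *
            ENNReal.ofReal (1 / ∏ i, (n i : ℝ) ^ ks.get i) else 0) := by
        intro n
        have hsup : Finset.univ.sup n < N ↔ ∀ i, n i < N := by
          simp [Finset.sup_lt_iff (show ⊥ < N from hN)]
        simp only [strictAnti_cons, Fin.forall_fin_succ, hsup]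
        by_cases hlt : ∀ i, n i < N
        · by_cases hn : StrictAnti n ∧ ∀ i, 0 < n i
          · rw [if_pos (by simpa [hlt, hN] using hn), if_pos hn, if_pos hlt, sup_cons N n hlt,
              Fin.prod_univ_succ, one_mul, mul_assoc, ← ENNReal.ofReal_mul (by positivity)]
            congr 2
            simp [mul_comm]
          · rw [if_neg (by simpa [hlt, hN] using hn), if_neg hn, mul_zero]
        · rw [if_neg (fun h => hlt h.1.1), if_neg hlt]
          simp
      refine (tsum_congr h₁).trans ?_
      -- The constraint that the remaining indices lie below `N` is absorbed into the weight; this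
      -- is why the induction runs over all `φ`.
      rw [ENNReal.tsum_mul_left, ih fun m => if m < N then 1 else 0, mul_assoc]
      congr 1
      rw [tsum_eq_sum (s := Finset.range N) (fun m hm => by
        rw [if_neg (by simpa using hm), zero_mul]), mzvCoeff,
        div_eq_mul_one_div (∑ m ∈ _, mzvCoeff ks m), mul_comm (∑ m ∈ _, mzvCoeff ks m), ENNReal.ofReal_mul (by positivity), ENNReal.ofReal_sum_of_nonneg fun m _ =>
          mzvCoeff_nonneg ks m]
      congr 1
      refine Finset.sum_congr rfl fun m hm => ?_
      rw [if_pos (Finset.mem_range.mp hm), one_mul]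

/-- Summation over tuples is regrouped in `ℝ≥0∞`, where no convergence is needed; a divergent series
gives `0` on both sides. -/
theorem mzv_eq_tsum (k : List ℕ) : mzv k = ((∑' n, mzvCoeff k n : ℝ) : ℂ) := by
  classical
  have h₁ : mzv k = ((∑' n : {n : Fin k.length → ℕ // StrictAnti n ∧ ∀ i, 0 < n i},
      1 / ∏ i, ((n.1 i : ℝ) ^ k.get i) : ℝ) : ℂ) := by
    rw [mzv, Complex.ofReal_tsum]
    push_cast
    rfl
  rw [h₁]
  congr 1
  have h₂ : ∀ {α : Type} (f : α → ℝ), (∀ a, 0 ≤ f a) →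
      ∑' a, f a = (∑' a, ENNReal.ofReal (f a)).toReal := by
    intro α f hf
    rw [ENNReal.tsum_toReal_eq fun a => ENNReal.ofReal_ne_top]
    exact tsum_congr fun a => (ENNReal.toReal_ofReal (hf a)).symm
  rw [h₂ _ fun n => by positivity, h₂ _ (mzvCoeff_nonneg k)]
  congr 1
  have h₃ := tsum_mzv_weighted k fun _ => 1
  simp only [one_mul] at h₃
  rw [← h₃]
  refine (tsum_subtype {n : Fin k.length → ℕ | StrictAnti n ∧ ∀ i, 0 < n i}
    fun n => ENNReal.ofReal (1 / ∏ i, ((n i : ℝ) ^ k.get i))).trans ?_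
  refine tsum_congr fun n => ?_
  rw [Set.indicator_apply]
  rfl

theorem tendsto_LiWord_mzv {w : Word} (hw : EndsInY (Letter.x :: w)) :
    Filter.Tendsto (fun t : ℝ => LiWord (Letter.x :: w) t) (nhdsWithin 1 (Set.Iio 1))
      (nhds (mzv (exponents (Letter.x :: w)))) := by
  rw [mzv_eq_tsum, tsum_congr (mzvCoeff_exponents hw)]
  exact tendsto_LiWord_cons_x hw

/-! ### The cut plane -/

theorem mem_cutPlane_iff {z : ℂ} : z ∈ cutPlane ↔ z ∈ Complex.slitPlane ∧ z ∈ slitOne := by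
  rw [Complex.mem_slitPlane_iff, mem_slitOne]
  constructor
  · intro h
    by_cases him : z.im = 0
    · have hz : z = (z.re : ℂ) := Complex.ext (by simp) (by simp [him])
      have h₁ : ¬(z.re ≤ 0 ∨ 1 ≤ z.re) := fun hr => h z.re hr hz
      rw [not_or, not_le, not_le] at h₁
      exact ⟨Or.inl h₁.1, Or.inl h₁.2⟩
    · exact ⟨Or.inr him, Or.inr him⟩
  · rintro ⟨h₁, h₂⟩ r hr rfl
    simp only [Complex.ofReal_re, Complex.ofReal_im, ne_eq, not_true_eq_false, or_false] at h₁ h₂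
    rcases hr with hr | hr <;> linarith

theorem one_sub_mem_cutPlane {z : ℂ} (hz : z ∈ cutPlane) : 1 - z ∈ cutPlane := by
  rw [mem_cutPlane_iff] at hz ⊢
  exact ⟨hz.2, by simpa [slitOne] using hz.1⟩

theorem ofReal_mem_cutPlane {t : ℝ} (ht : t ∈ Set.Ioo (0 : ℝ) 1) : (t : ℂ) ∈ cutPlane := by
  rw [mem_cutPlane_iff, Complex.mem_slitPlane_iff, mem_slitOne]
  exact ⟨Or.inl (by simpa using ht.1), Or.inl (by simpa using ht.2)⟩

theorem ne_zero_of_mem_cutPlane {z : ℂ} (hz : z ∈ cutPlane) : z ≠ 0 :=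
  Complex.slitPlane_ne_zero (mem_cutPlane_iff.mp hz).1

theorem isOpen_cutPlane : IsOpen cutPlane := by
  have : cutPlane = Complex.slitPlane ∩ slitOne := Set.ext fun z => mem_cutPlane_iff
  rw [this]
  exact Complex.isOpen_slitPlane.inter isOpen_slitOne

/-- The centre `1 / 2` is fixed by `z ↦ 1 - z`, so both cuts reduce to star-convexity of
`Complex.slitPlane`. -/
theorem starConvex_cutPlane : StarConvex ℝ (((1 / 2 : ℝ) : ℂ)) cutPlane := by
  intro z hz a b ha hb hab
  have hb' := Complex.starConvex_ofReal_slitPlane (x := 1 / 2) (by norm_num)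
  rw [mem_cutPlane_iff] at hz ⊢
  refine ⟨hb' hz.1 ha hb hab, ?_⟩
  have h₁ := hb' hz.2 ha hb hab
  have hab' : (a : ℂ) + b = 1 := by exact_mod_cast hab
  have h₂ : 1 - (a • (((1 / 2 : ℝ) : ℂ)) + b • z) = a • (((1 / 2 : ℝ) : ℂ)) + b • (1 - z) := by
    simp only [Complex.real_smul]
    push_cast
    linear_combination -hab'
  rw [← h₂] at h₁
  exact h₁

theorem eq_of_hasDerivAt_zero {F : ℂ → ℂ} (hF : ∀ z ∈ cutPlane, HasDerivAt F 0 z) {z z' : ℂ}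
    (hz : z ∈ cutPlane) (hz' : z' ∈ cutPlane) : F z = F z' :=
  isOpen_cutPlane.is_const_of_deriv_eq_zero
    (starConvex_cutPlane.isPathConnected
      (ofReal_mem_cutPlane (by norm_num))).isConnected.isPreconnected
    (fun w hw => (hF w hw).differentiableAt.differentiableWithinAt)
    (fun w hw => (hF w hw).deriv) hz hz'

/-! ### Multiple polylogarithms as functionals on `𝔥¹` -/

theorem h1_induction {P : H → Prop} (zero : P 0) (add : ∀ f g, P f → P g → P (f + g))
    (smul : ∀ (c : ℂ) f, P f → P (c • f)) (word : ∀ w, EndsInY w → P (word w)) {f : H}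
    (hf : f ∈ h1) : P f := by
  rw [h1, Finsupp.supported_eq_span_single] at hf
  induction hf using Submodule.span_induction with
  | mem f hf =>
    obtain ⟨w, hw, rfl⟩ := hf
    exact word w hw
  | zero => exact zero
  | add f g _ _ hf hg => exact add f g hf hg
  | smul c f _ hf => exact smul c f hf

/-- `Li(·; z)` on `𝔥¹`, extended by the same formula to a functional on `𝔥`. -/
noncomputable def LiOneLinear (z : ℂ) : H →ₗ[ℂ] ℂ :=
  Finsupp.linearCombination ℂ fun w => LiWord w z

theorem LiOneLinear_word (w : Word) (z : ℂ) : LiOneLinear z (word w) = LiWord w z := by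
  simp [LiOneLinear, word]

theorem LiOneLinear_zero (f : H) : LiOneLinear 0 f = f [] := by
  have : LiOneLinear 0 = Finsupp.lapply [] := word_ext fun w => by
    rw [LiOneLinear_word, Finsupp.lapply_apply]
    cases w with
    | nil => rw [word_nil_nil]; rfl
    | cons a w => rw [LiWord_cons_zero, ← cons_word, cons_apply_nil]
  rw [this]; rfl

theorem differentiableOn_LiOneLinear {f : H} (hf : f ∈ h1) :
    DifferentiableOn ℂ (fun z => LiOneLinear z f) slitOne := by
  refine h1_induction (P := fun f => DifferentiableOn ℂ (fun z => LiOneLinear z f) slitOne)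
    (by simp) (fun f g hf hg => ?_) (fun c f hf => ?_) (fun w hw => ?_) hf
  · simp only [map_add]; exact hf.add hg
  · simp only [map_smul]; exact hf.const_smul c
  · simpa only [LiOneLinear_word] using differentiableOn_LiWord hw

theorem hasDerivAt_LiOneLinear {f : H} (hf : f ∈ h1) {z : ℂ} (hz : z ∈ slitOne) (hz0 : z ≠ 0) :
    HasDerivAt (fun z => LiOneLinear z f)
      (kernel Letter.x z * LiOneLinear z (dropHead Letter.x f) +
        kernel Letter.y z * LiOneLinear z (dropHead Letter.y f)) z := by
  refine h1_induction (P := fun f => HasDerivAt (fun z => LiOneLinear z f)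
      (kernel Letter.x z * LiOneLinear z (dropHead Letter.x f) +
        kernel Letter.y z * LiOneLinear z (dropHead Letter.y f)) z) ?_ (fun f g hf hg => ?_) (fun c f hf => ?_) (fun w hw => ?_) hf
  · simpa using hasDerivAt_const z (0 : ℂ)
  · simp only [map_add]
    exact (hf.add hg).congr_deriv (by ring)
  · simp only [map_smul, smul_eq_mul]
    exact (hf.const_mul c).congr_deriv (by ring)
  · simp only [LiOneLinear_word]
    cases w with
    | nil =>
      simp only [dropHead_nil, map_zero, mul_zero, add_zero]
      exact hasDerivAt_const z 1
    | cons a w =>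
      refine (hasDerivAt_LiWord_cons hw hz hz0).congr_deriv ?_
      rw [← cons_word]
      cases a
      · rw [dropHead_cons_same, dropHead_cons_ne (by simp), LiOneLinear_word]; simp
      · rw [dropHead_cons_same, dropHead_cons_ne (by simp), LiOneLinear_word]; simp

theorem dropHead_word {w : Word} (hw : EndsInY w) (a : Letter) : dropHead a (word w) = 0 ∨
    ∃ u : Word, EndsInY u ∧ u.length < w.length ∧ dropHead a (word w) = word u := by
  cases w with
  | nil => exact Or.inl (dropHead_nil a)
  | cons b w =>
    rw [← cons_word]
    by_cases h : b = a
    · subst h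
      exact Or.inr ⟨w, hw.of_cons, by simp, dropHead_cons_same _ _⟩
    · exact Or.inl (dropHead_cons_ne h _)

/-- Since `dropHead` is a derivation, induction on total length shows that both sides have the same
derivative. They agree at `0`, where `LiOneLinear` takes the constant term, which is multiplicative.
-/
theorem LiOneLinear_shuffle_word (N : ℕ) : ∀ u v : Word, EndsInY u → EndsInY v →
    u.length + v.length < N → ∀ z ∈ cutPlane,
      LiOneLinear z (shuffle (word u) (word v)) =
        LiOneLinear z (word u) * LiOneLinear z (word v) := by
  induction N with
  | zero => intro u v _ _ h; omega
  | succ N ih =>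
    intro u v hu hv hN
    have hu1 := word_mem_h1 hu
    have hv1 := word_mem_h1 hv
    have hl : ∀ a, ∀ z ∈ cutPlane, LiOneLinear z (shuffle (dropHead a (word u)) (word v)) =
        LiOneLinear z (dropHead a (word u)) * LiOneLinear z (word v) := by
      intro a z hz
      rcases dropHead_word hu a with h | ⟨u', hu', hlt, h⟩
      · simp [h]
      · rw [h, ih u' v hu' hv (by omega) z hz]
    have hr : ∀ a, ∀ z ∈ cutPlane, LiOneLinear z (shuffle (word u) (dropHead a (word v))) =
        LiOneLinear z (word u) * LiOneLinear z (dropHead a (word v)) := by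
      intro a z hz
      rcases dropHead_word hv a with h | ⟨v', hv', hlt, h⟩
      · simp [h]
      · rw [h, ih u v' hu hv' (by omega) z hz]
    set F : ℂ → ℂ := fun z => LiOneLinear z (shuffle (word u) (word v)) -
      LiOneLinear z (word u) * LiOneLinear z (word v) with hF
    have hderiv : ∀ z ∈ cutPlane, HasDerivAt F 0 z := by
      intro z hz
      have hs := (mem_cutPlane_iff.mp hz).2
      have h0 := ne_zero_of_mem_cutPlane hz
      refine ((hasDerivAt_LiOneLinear (shuffle_mem_h1 hu1 hv1) hs h0).sub
        ((hasDerivAt_LiOneLinear hu1 hs h0).mul (hasDerivAt_LiOneLinear hv1 hs h0))).congr_deriv ?_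
      simp only [dropHead_shuffle, map_add, hl _ z hz, hr _ z hz]
      ring
    have hcont : ContinuousAt F 0 :=
      ((differentiableOn_LiOneLinear (shuffle_mem_h1 hu1 hv1)).sub
        ((differentiableOn_LiOneLinear hu1).mul
          (differentiableOn_LiOneLinear hv1))).continuousOn.continuousAt
        (isOpen_slitOne.mem_nhds zero_mem_slitOne)
    have hF0 : F 0 = 0 := by
      simp only [hF, LiOneLinear_zero, shuffle_apply_nil, sub_self]
    intro z hz
    -- The cut plane omits `0`, so the initial value is reached as a limit along the positive reals.
    have hlim : Filter.Tendsto (fun t : ℝ => F t) (nhdsWithin 0 (Set.Ioi 0)) (nhds 0) := by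
      rw [← hF0]
      refine (hcont.tendsto.comp ?_).mono_left nhdsWithin_le_nhds
      exact Complex.continuous_ofReal.tendsto' 0 0 Complex.ofReal_zero
    have hconst : Filter.Tendsto (fun t : ℝ => F t) (nhdsWithin 0 (Set.Ioi 0)) (nhds (F z)) := by
      refine tendsto_const_nhds.congr' ?_
      filter_upwards [Ioo_mem_nhdsGT (zero_lt_one (α := ℝ))] with t ht
      exact eq_of_hasDerivAt_zero hderiv hz (ofReal_mem_cutPlane ht)
    exact sub_eq_zero.mp (tendsto_nhds_unique hconst hlim)

theorem LiOneLinear_shuffle {f g : H} (hf : f ∈ h1) (hg : g ∈ h1) {z : ℂ} (hz : z ∈ cutPlane) :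
    LiOneLinear z (shuffle f g) = LiOneLinear z f * LiOneLinear z g := by
  refine h1_induction
    (P := fun f => LiOneLinear z (shuffle f g) = LiOneLinear z f * LiOneLinear z g)
    (by simp) (fun f f' hf hf' => ?_) (fun c f hf => ?_) (fun u hu => ?_) hf
  · simp only [map_add, LinearMap.add_apply, hf, hf', add_mul]
  · simp only [map_smul, LinearMap.smul_apply, hf, smul_mul_assoc]
  refine h1_induction (P := fun g => LiOneLinear z (shuffle (word u) g) =
    LiOneLinear z (word u) * LiOneLinear z g) (by simp) (fun g g' hg hg' => ?_) (fun c g hg => ?_) (fun v hv => ?_) hg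
  · simp only [map_add, hg, hg', mul_add]
  · simp only [map_smul, hg, mul_smul_comm]
  exact LiOneLinear_shuffle_word _ u v hu hv (Nat.lt_succ_self _) z hz

/-! ### Multiple polylogarithms as functionals on `𝔥` -/

/-- `Li(·; z)` as a functional on `𝔥`. -/
noncomputable def LiLinear (z : ℂ) : H →ₗ[ℂ] ℂ :=
  (Finsupp.lsum ℂ fun n : ℕ => (Complex.log z ^ n) • (LiOneLinear z ∘ₗ h1.subtype)) ∘ₗ
    decompX.symm.toLinearMap

theorem LiLinear_apply (z : ℂ) (f : H) : LiLinear z f = Li f z := by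
  simp only [LiLinear, LinearMap.comp_apply, LinearEquiv.coe_coe, Finsupp.lsum_apply, Li,
    Finsupp.sum]
  refine Finset.sum_congr rfl fun n _ => ?_
  rw [LinearMap.smul_apply, smul_eq_mul, mul_comm]
  rfl

theorem LiLinear_shuffle_pow {c : H} (hc : c ∈ h1) (n : ℕ) (z : ℂ) :
    LiLinear z (shuffle c (shufflePow (word [Letter.x]) n)) =
      LiOneLinear z c * Complex.log z ^ n := by
  have h : decompX (Finsupp.single n ⟨c, hc⟩) =
      shuffle c (shufflePow (word [Letter.x]) n) := by
    change sumX _ = _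
    simp [sumX]
  rw [← h, LiLinear, LinearMap.comp_apply, LinearEquiv.coe_coe, LinearEquiv.symm_apply_apply,
    Finsupp.lsum_single, LinearMap.smul_apply, smul_eq_mul, mul_comm]
  rfl

theorem LiLinear_of_mem_h1 {c : H} (hc : c ∈ h1) (z : ℂ) : LiLinear z c = LiOneLinear z c := by
  simpa [shufflePow, shuffle_nil] using LiLinear_shuffle_pow hc 0 z

theorem LiLinear_word {w : Word} (hw : EndsInY w) (z : ℂ) :
    LiLinear z (word w) = LiWord w z := by
  rw [LiLinear_of_mem_h1 (word_mem_h1 hw), LiOneLinear_word]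

theorem LiLinear_nil (z : ℂ) : LiLinear z (word []) = 1 := LiLinear_word (Or.inl rfl) z

theorem LiLinear_x (z : ℂ) : LiLinear z (word [Letter.x]) = Complex.log z := by
  have := LiLinear_shuffle_pow (word_mem_h1 (Or.inl rfl)) 1 z
  rw [nil_shuffle, shufflePow, shufflePow, nil_shuffle, LiOneLinear_word, pow_one] at this
  rw [this]
  exact one_mul _

theorem induction_shuffle_pow {P : H → Prop} (zero : P 0) (add : ∀ f g, P f → P g → P (f + g))
    (pow : ∀ c ∈ h1, ∀ n, P (shuffle c (shufflePow (word [Letter.x]) n))) (f : H) : P f := by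
  obtain ⟨c, rfl⟩ := decompX.surjective f
  change P (sumX c)
  induction c using Finsupp.induction_linear with
  | zero => simpa using zero
  | add c d hc hd => rw [map_add]; exact add _ _ hc hd
  | single n c =>
    have : sumX (Finsupp.single n c) = shuffle c (shufflePow (word [Letter.x]) n) := by
      simp [sumX]
    rw [this]
    exact pow c c.2 n

theorem LiLinear_shuffle {z : ℂ} (hz : z ∈ cutPlane) (f g : H) :
    LiLinear z (shuffle f g) = LiLinear z f * LiLinear z g := by
  refine induction_shuffle_pow
    (P := fun f => LiLinear z (shuffle f g) = LiLinear z f * LiLinear z g)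
    (by simp) (fun f f' hf hf' => ?_) (fun c hc m => ?_) f
  · simp only [map_add, LinearMap.add_apply, hf, hf', add_mul]
  refine induction_shuffle_pow (P := fun g => LiLinear z (shuffle
    (shuffle c (shufflePow (word [Letter.x]) m)) g) =
      LiLinear z (shuffle c (shufflePow (word [Letter.x]) m)) * LiLinear z g)
    (by simp) (fun g g' hg hg' => ?_) (fun d hd n => ?_) g
  · simp only [map_add, hg, hg', mul_add]
  rw [shuffle_shufflePow_shuffle, LiLinear_shuffle_pow (shuffle_mem_h1 hc hd),
    LiLinear_shuffle_pow hc, LiLinear_shuffle_pow hd, LiOneLinear_shuffle hc hd hz, pow_add]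
  ring

/-- On `c ⧢ x^n` this is the product rule: removing `x` from `x^n` gives `n x^(n-1)`, matching the
derivative of `log^n`, and removing `y` gives `0`. -/
theorem hasDerivAt_LiLinear {z : ℂ} (hz : z ∈ cutPlane) (f : H) :
    HasDerivAt (fun z => LiLinear z f)
      (kernel Letter.x z * LiLinear z (dropHead Letter.x f) +
        kernel Letter.y z * LiLinear z (dropHead Letter.y f)) z := by
  refine induction_shuffle_pow (P := fun f => HasDerivAt (fun z => LiLinear z f)
      (kernel Letter.x z * LiLinear z (dropHead Letter.x f) +
        kernel Letter.y z * LiLinear z (dropHead Letter.y f)) z) ?_ (fun f g hf hg => ?_) (fun c hc n => ?_) f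
  · simpa using hasDerivAt_const z (0 : ℂ)
  · simp only [map_add]
    exact (hf.add hg).congr_deriv (by ring)
  · have hy : dropHead Letter.y (shufflePow (word [Letter.x]) n) = 0 := dL_pow_x n
    have hc' := hasDerivAt_LiOneLinear hc (mem_cutPlane_iff.mp hz).2 (ne_zero_of_mem_cutPlane hz)
    have hlog := (Complex.hasDerivAt_log (mem_cutPlane_iff.mp hz).1).pow n
    simp only [LiLinear_shuffle_pow hc, dropHead_shuffle, hy, map_zero, add_zero,
      LiLinear_shuffle_pow (dropHead_mem_h1 _ hc), map_add]
    refine (hc'.mul hlog).congr_deriv ?_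
    cases n with
    | zero =>
      rw [shufflePow, dropHead_nil]
      simp
    | succ n =>
      rw [dropHead_x_pow_x, map_smul, map_smul, LiLinear_shuffle_pow hc]
      simp only [Pi.pow_apply, Nat.add_sub_cancel, smul_eq_mul, kernel]
      push_cast
      ring

theorem hasDerivAt_LiLinear_cons {z : ℂ} (hz : z ∈ cutPlane) (a : Letter) (w : Word) :
    HasDerivAt (fun z => LiLinear z (word (a :: w))) (kernel a z * LiLinear z (word w)) z := by
  refine (hasDerivAt_LiLinear hz _).congr_deriv ?_
  rw [← cons_word]
  cases a
  · rw [dropHead_cons_same, dropHead_cons_ne (by simp)]; simp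
  · rw [dropHead_cons_same, dropHead_cons_ne (by simp)]; simp

theorem kernel_swap (a : Letter) (z : ℂ) : kernel (swap a) (1 - z) = kernel a z := by
  cases a <;> simp [kernel, swap]

/-! ### The connection formula -/

/-- The sum over all factorizations in the connection formula, as a functional on `𝔥`. -/
noncomputable def connection (z : ℂ) : H →ₗ[ℂ] ℂ :=
  convolution (LiLinear (1 - z) ∘ₗ tauLinear) (LiLinear z)

theorem connection_word (z : ℂ) (w : Word) : connection z (word w) =
    ∑ i ∈ Finset.range (w.length + 1),
      LiLinear (1 - z) (word (tau (w.take i))) * LiLinear z (word (w.drop i)) := by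
  simp [connection, convolution_word, tauLinear_word]

theorem connection_shuffle {z : ℂ} (hz : z ∈ cutPlane) (f g : H) :
    connection z (shuffle f g) = connection z f * connection z g :=
  convolution_shuffle (fun f g => by
    simp only [LinearMap.comp_apply, tauLinear_shuffle, LiLinear_shuffle (one_sub_mem_cutPlane hz)])
    (LiLinear_shuffle hz) f g

theorem hasDerivAt_connection (w : Word) {z : ℂ} (hz : z ∈ cutPlane) :
    HasDerivAt (fun z => connection z (word w)) 0 z := by
  set A : ℕ → ℂ → ℂ := fun i z => LiLinear (1 - z) (word (tau (w.take i))) with hA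
  set B : ℕ → ℂ → ℂ := fun i z => LiLinear z (word (w.drop i)) with hB
  -- `E (i + 1)` arises when the letter `w[i]` is stripped from the suffix in term `i`, and with a
  -- minus sign when it is stripped from the prefix in term `i + 1`. Both ends of the telescope are
  -- `0`, an empty word having nothing to strip.
  set E : ℕ → ℂ := fun i => Nat.casesOn i 0 fun i =>
    if h : i < w.length then kernel w[i] z * A i z * B (i + 1) z else 0 with hE
  have hterm : ∀ i ∈ Finset.range (w.length + 1),
      HasDerivAt (fun z => A i z * B i z) (E (i + 1) - E i) z := by
    intro i hi
    have hA' : ∃ α, HasDerivAt (A i) α z ∧ α * B i z = -E i := by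
      cases i with
      | zero =>
        refine ⟨0, ?_, by simp [hE]⟩
        have : A 0 = fun _ => 1 := by
          ext s; exact LiLinear_nil _
        rw [this]; exact hasDerivAt_const z 1
      | succ i =>
        have hlt : i < w.length := by simpa using hi
        refine ⟨-(kernel w[i] z * A i z), ?_, by simp [hE, hlt]⟩
        have h₁ : tau (w.take (i + 1)) = swap w[i] :: tau (w.take i) := by
          rw [← List.take_concat_get' w i hlt, tau_concat]
        have h₂ := (hasDerivAt_LiLinear_cons (one_sub_mem_cutPlane hz) (swap w[i])
          (tau (w.take i))).comp z ((hasDerivAt_id z).const_sub 1)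
        rw [kernel_swap, ← h₁] at h₂
        exact h₂.congr_deriv (by simp [hA])
    have hB' : ∃ β, HasDerivAt (B i) β z ∧ A i z * β = E (i + 1) := by
      rcases (Nat.lt_succ_iff.mp (Finset.mem_range.mp hi)).lt_or_eq with hlt | heq
      · refine ⟨kernel w[i] z * B (i + 1) z, ?_, by simp [hE, hlt]; ring⟩
        have h₁ := hasDerivAt_LiLinear_cons hz w[i] (w.drop (i + 1))
        rw [← List.drop_eq_getElem_cons hlt] at h₁
        exact h₁
      · refine ⟨0, ?_, by simp [hE, heq]⟩
        have : B i = fun _ => 1 := by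
          ext s
          simp only [hB, heq, List.drop_length]
          exact LiLinear_nil _
        rw [this]; exact hasDerivAt_const z 1
    obtain ⟨α, hα, hα'⟩ := hA'
    obtain ⟨β, hβ, hβ'⟩ := hB'
    exact (hα.mul hβ).congr_deriv (by rw [hα', hβ']; ring)
  have hsum := HasDerivAt.fun_sum hterm
  rw [Finset.sum_range_sub] at hsum
  simp only [connection_word]
  exact hsum.congr_deriv (by simp [hE])

/-! ### Evaluation by limits at `1`. -/

theorem connection_eq_of_tendsto (w : Word) {z : ℂ} (hz : z ∈ cutPlane) {a : ℂ}
    (h : Filter.Tendsto (fun t : ℝ => connection t (word w)) (nhdsWithin 1 (Set.Iio 1)) (nhds a)) :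
    connection z (word w) = a := by
  refine tendsto_nhds_unique (tendsto_const_nhds.congr' ?_) h
  filter_upwards [eventually_mem_Ioo] with t ht
  exact eq_of_hasDerivAt_zero (fun z hz => hasDerivAt_connection w hz) hz (ofReal_mem_cutPlane ht)

theorem tendsto_LiWord_one_sub {w : Word} (hw : EndsInY w) (hne : w ≠ []) :
    Filter.Tendsto (fun t : ℝ => LiWord w (1 - t)) (nhdsWithin 1 (Set.Iio 1)) (nhds 0) := by
  have h := ((differentiableOn_LiWord hw).continuousOn.continuousAt
    (isOpen_slitOne.mem_nhds zero_mem_slitOne)).tendsto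
  rw [LiWord_zero hne] at h
  refine (h.comp ?_).mono_left nhdsWithin_le_nhds
  exact Continuous.tendsto' (by fun_prop) _ _ (by simp)

theorem endsInY_y : EndsInY [Letter.y] := Or.inr ⟨[], rfl⟩

theorem connection_x {z : ℂ} (hz : z ∈ cutPlane) : connection z (word [Letter.x]) = 0 := by
  refine connection_eq_of_tendsto _ hz ?_
  have h₁ : ∀ t : ℝ, connection t (word [Letter.x]) = Complex.log t + LiWord [Letter.y] (1 - t) := by
    intro t
    have : tau [Letter.x] = [Letter.y] := rfl
    have h' : tau [] = [] := rfl
    simp [connection_word, Finset.sum_range_succ, LiLinear_nil, LiLinear_x, this, h',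
      LiLinear_word endsInY_y]
  simp_rw [h₁]
  have hlog : Filter.Tendsto (fun t : ℝ => Complex.log t) (nhdsWithin 1 (Set.Iio 1)) (nhds 0) := by
    refine Filter.Tendsto.mono_left ?_ nhdsWithin_le_nhds
    have hc : ContinuousAt (fun t : ℝ => Complex.log t) 1 :=
      ContinuousAt.clog Complex.continuous_ofReal.continuousAt (by simp)
    simpa using hc.tendsto
  simpa using hlog.add (tendsto_LiWord_one_sub endsInY_y (by simp))

theorem connection_y {z : ℂ} (hz : z ∈ cutPlane) : connection z (word [Letter.y]) = 0 := by
  rw [← connection_x (one_sub_mem_cutPlane hz)]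
  have h₁ : tau [Letter.x] = [Letter.y] := rfl
  have h₂ : tau [Letter.y] = [Letter.x] := rfl
  have h₃ : tau [] = [] := rfl
  simp [connection_word, Finset.sum_range_succ, LiLinear_nil, LiLinear_x, h₁, h₂, h₃, add_comm]

/-- Write the product as `(Li(u; 1 - t) / (1 - t)) * ((1 - t) Li(v; t))`. The first factor tends to
the derivative at `0`, the second to `0`, even when `Li(v; t)` itself diverges. -/
theorem tendsto_LiWord_mul_LiWord {u v : Word} (hu : EndsInY u) (hne : u ≠ [])
    (hv : EndsInY v) : Filter.Tendsto (fun t : ℝ => LiWord u (1 - t) * LiWord v t)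
      (nhdsWithin 1 (Set.Iio 1)) (nhds 0) := by
  have hd : HasDerivAt (LiWord u) (deriv (LiWord u) 0) 0 :=
    ((differentiableOn_LiWord hu).differentiableAt
      (isOpen_slitOne.mem_nhds zero_mem_slitOne)).hasDerivAt
  rw [hasDerivAt_iff_tendsto_slope] at hd
  have hsub : Filter.Tendsto (fun t : ℝ => 1 - (t : ℂ)) (nhdsWithin 1 (Set.Iio 1))
      (nhdsWithin 0 {0}ᶜ) := by
    refine tendsto_nhdsWithin_iff.mpr ⟨?_, ?_⟩
    · exact (Continuous.tendsto' (by fun_prop) _ _ (by simp)).mono_left nhdsWithin_le_nhds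
    · filter_upwards [eventually_mem_Ioo] with t ht
      exact ne_zero_of_mem_cutPlane (one_sub_mem_cutPlane (ofReal_mem_cutPlane ht))
  have h := (hd.comp hsub).mul (tendsto_one_sub_mul_LiWord hv)
  rw [mul_zero] at h
  refine h.congr' ?_
  filter_upwards [eventually_mem_Ioo] with t ht
  have h0 : 1 - (t : ℂ) ≠ 0 :=
    ne_zero_of_mem_cutPlane (one_sub_mem_cutPlane (ofReal_mem_cutPlane ht))
  simp only [Function.comp_apply, slope_def_field, LiWord_zero hne, sub_zero]
  field_simp

theorem connection_nil (z : ℂ) : connection z (word []) = mzv (exponents []) := by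
  have h : tau [] = [] := rfl
  have h₁ : connection z (word []) = 1 := by simp [connection_word, h, LiLinear_nil]
  rw [h₁, mzv_eq_tsum, tsum_eq_single 0 fun n hn => by simp [exponents, exponentsAux, mzvCoeff, hn]]
  simp [exponents, exponentsAux, mzvCoeff]

/-- As the word starts with `x` and ends in `y`, all prefixes after `τ` and all suffixes lie in
`𝔥¹`, so no logarithms occur and only the empty prefix survives in the limit. -/
theorem connection_cons_x {w : Word} (hw : EndsInY (Letter.x :: w)) {z : ℂ} (hz : z ∈ cutPlane) :
    connection z (word (Letter.x :: w)) = mzv (exponents (Letter.x :: w)) := by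
  refine connection_eq_of_tendsto _ hz ?_
  simp_rw [connection_word, List.length_cons, Finset.sum_range_succ' _ (w.length + 1)]
  have hlim : Filter.Tendsto (fun t : ℝ => ∑ i ∈ Finset.range (w.length + 1),
      LiLinear (1 - (t : ℂ)) (word (tau ((Letter.x :: w).take (i + 1)))) *
        LiLinear (t : ℂ) (word ((Letter.x :: w).drop (i + 1))))
      (nhdsWithin 1 (Set.Iio 1)) (nhds (∑ i ∈ Finset.range (w.length + 1), 0)) := by
    refine tendsto_finsetSum _ fun i _ => ?_
    have hu : tau ((Letter.x :: w).take (i + 1)) = tau (w.take i) ++ [Letter.y] := by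
      rw [List.take_succ_cons, tau_cons]; rfl
    have hu' : EndsInY (tau ((Letter.x :: w).take (i + 1))) := Or.inr ⟨_, hu⟩
    simp only [LiLinear_word hu', LiLinear_word (hw.drop (i + 1))]
    exact tendsto_LiWord_mul_LiWord hu' (by rw [hu]; simp) (hw.drop _)
  have h : tau [] = [] := rfl
  have h₀ := hlim.add (tendsto_LiWord_mzv hw)
  rw [Finset.sum_const_zero, zero_add] at h₀
  refine h₀.congr fun t => ?_
  simp [h, LiLinear_nil, LiLinear_word hw]

theorem connection_h0 {z : ℂ} (hz : z ∈ cutPlane) (f : h0) :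
    connection z (f : H) = zetaHat f := by
  rcases f with ⟨f, hf⟩
  change connection z f = Finsupp.linearCombination ℂ (fun w => mzv (exponents w)) f
  rw [h0, Finsupp.supported_eq_span_single] at hf
  induction hf using Submodule.span_induction with
  | mem f hf =>
    obtain ⟨w, hw, rfl⟩ := hf
    rw [Finsupp.linearCombination_single, one_smul]
    rcases hw with rfl | ⟨u, rfl⟩
    · exact connection_nil z
    · exact connection_cons_x (Or.inr ⟨Letter.x :: u, rfl⟩) hz
  | zero => simp
  | add f g _ _ hf hg => rw [map_add, map_add, hf, hg]
  | smul c f _ hf => rw [map_smul, map_smul, hf]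

end MPL

theorem mainTheorem3 (w : MPL.Word) (z : ℂ) (hz : z ∈ MPL.cutPlane) :
    ∑ i ∈ Finset.range (w.length + 1),
      MPL.Li (MPL.word (MPL.tau (w.take i))) (1 - z) * MPL.Li (MPL.word (w.drop i)) z =
    MPL.zetaHat (MPL.reg (MPL.word w)) := by
  simp only [← MPL.LiLinear_apply]
  rw [← MPL.connection_word, ← MPL.connection_h0 hz]
  exact MPL.eq_comp_reg (MPL.connection_shuffle hz) (MPL.connection_x hz) (MPL.connection_y hz) _
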